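/- For integers $k\ge 1$ and $W\ge 0$ with $k\le 2^W$, let $S(k,W)$ be the set of ordered partitions $P=[p_1,\dots,p_k]$ of $2^W$ into $k$ positive integers, $\sum_i p_i=2^W$. Add an extra index $0$ with initial weight $p_0=0$. A transaction of size $m$ from $i$ to $j$ ($i,j\in\{0,\dots,k\}$) replaces $p_i$ by $p_i-m$ and $p_j$ by $p_j+m$ (weights may become negative in the process). Let $\lambda(P)$ be the length of a shortest sequence of transactions, each of size a power of two, after which $p_1=\dots=p_k=0$. Let $$L(k,W)=\frac{\mathbb{E}[\lambda(P)]}{Wk}\quad (W\ge 1),$$ where $P$ is uniformly random in $S(k,W)$, and let $L(k)=\lim_{W\to\infty}L(k,W)$. Let $RW(p,n)=\mathbb{E}|X_1+\dots+X_n|$, where $X_1,\dots,X_n$ are independent and each $X_i$ is $-1$ with probability $p$, $1$ with probability $p$, and $0$ with probability $1-2p$. Put $$c(k)=\frac{1+RW\left(\tfrac16,k-1\right)}{2k}.$$ Theorem. For every integer $k\ge 1$ the limit $L(k)$ exists and $L(k)\le \frac16+c(k)$. Furthermore, $$\lim_{k\to\infty}\sqrt{6\pi k}\cdot c(k)=1\qquad\text{and}\qquad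 \lim_{k\to\infty}L(k)=\frac16 .$$ -/

import Mathlib

open Filter Topology

namespace TCAM

/-- A transaction between the targets `1, …, k` (written `some i`, `i : Fin k`) and the special
target `0` of unallocated addresses (written `none`); its size is `2 ^ exponent`. A transaction
from a target to itself changes nothing, so allowing it does not affect shortest sequences. -/
structure Transaction (k : ℕ) where
  src : Option (Fin k)
  dst : Option (Fin k)
  exponent : ℕ

/-- The effect of a transaction: subtract its size at the source, add it at the destination. -/
def Transaction.apply {k : ℕ} (x : Option (Fin k) → ℤ) (t : Transaction k) :
    Option (Fin k) → ℤ :=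
  fun v => x v - (if v = t.src then 2 ^ t.exponent else 0)
    + (if v = t.dst then 2 ^ t.exponent else 0)

/-- The weights before any transaction: target `i` has weight `p i`, and no address is
unallocated. -/
def initialWeights {k : ℕ} (p : Fin k → ℕ) : Option (Fin k) → ℤ
  | none => 0
  | some i => (p i : ℤ)

/-- The sequence `s` of transactions, applied in order, zeroes `p₁, …, pₖ`. -/
def Zeroes {k : ℕ} (s : List (Transaction k)) (p : Fin k → ℕ) : Prop :=
  ∀ i : Fin k, s.foldl Transaction.apply (initialWeights p) (some i) = 0

/-- The complexity `λ(P)`: the length of a shortest sequence of transactions, of sizes that are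
powers of two, that zeroes `P`. -/
noncomputable def complexity {k : ℕ} (p : Fin k → ℕ) : ℕ :=
  sInf {n : ℕ | ∃ s : List (Transaction k), Zeroes s p ∧ s.length = n}

/-- Every vector of weights can be zeroed, so the infimum in `complexity` is attained. -/
theorem exists_zeroes {k : ℕ} (p : Fin k → ℕ) : ∃ s : List (Transaction k), Zeroes s p := by
  suffices h : ∀ (n : ℕ) (x : Option (Fin k) → ℤ), (∀ i, 0 ≤ x (some i)) →
      ∑ i, x (some i) = n → ∃ s : List (Transaction k),
        ∀ i, s.foldl Transaction.apply x (some i) = 0 by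
    obtain ⟨s, hs⟩ := h (∑ i, p i) (initialWeights p) (fun i => by simp [initialWeights])
      (by simp [initialWeights])
    exact ⟨s, hs⟩
  intro n
  induction n with
  | zero =>
    intro x hx hsum
    refine ⟨[], fun i => ?_⟩
    have := (Finset.sum_eq_zero_iff_of_nonneg (fun i _ => hx i)).1 (by simpa using hsum)
    simpa using this i (Finset.mem_univ i)
  | succ n ih =>
    intro x hx hsum
    have hpos : ∃ j, 0 < x (some j) := by
      by_contra! hcon
      have : ∑ i, x (some i) ≤ 0 := Finset.sum_nonpos (fun i _ => hcon i)
      push_cast at hsum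
      omega
    obtain ⟨j, hj⟩ := hpos
    obtain ⟨s, hs⟩ := ih (Transaction.apply x ⟨some j, none, 0⟩)
      (fun i => by
        by_cases hij : i = j
        · subst hij; simp [Transaction.apply]; omega
        · simpa [Transaction.apply, hij] using hx i)
      (by simp [Transaction.apply, Finset.sum_sub_distrib, hsum])
    exact ⟨⟨some j, none, 0⟩ :: s, hs⟩

/-- The ordered partitions of `2 ^ W` into `k` positive parts. -/
def orderedPartitions (k W : ℕ) : Finset (Fin k → ℕ) :=
  (Finset.piAntidiag Finset.univ (2 ^ W)).filter (fun p => ∀ i, 0 < p i)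

/-- The expectation of `λ(P)` for a uniformly random ordered partition `P` of `2 ^ W` into `k`
positive parts (meaningful when there is one, that is, when `1 ≤ k ≤ 2 ^ W`). -/
noncomputable def expectedComplexity (k W : ℕ) : ℝ :=
  (∑ p ∈ orderedPartitions k W, (complexity p : ℝ)) / ((orderedPartitions k W).card : ℝ)

/-- The normalized expected complexity `L(k, W)`. -/
noncomputable def normalizedComplexity (k W : ℕ) : ℝ :=
  expectedComplexity k W / ((W : ℝ) * (k : ℝ))

/-- `L(k)`, the limit of `L(k, W)` as `W → ∞`. -/
noncomputable def limitComplexity (k : ℕ) : ℝ :=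
  limUnder atTop (fun W : ℕ => normalizedComplexity k W)

/-- The law of one step of the lazy symmetric walk: `-1` and `1` with probability `p` each, and
`0` with probability `1 - 2 p`. -/
def stepProb (p : ℝ) (a : SignType) : ℝ :=
  if a = 0 then 1 - 2 * p else p

/-- `RW(p, n)`: the expected distance `E|X₁ + ⋯ + Xₙ|` from the origin after `n` independent steps
of the lazy symmetric walk, as a sum over all sequences of `n` steps. -/
noncomputable def expectedDistance (p : ℝ) (n : ℕ) : ℝ :=
  ∑ s : Fin n → SignType, (∏ i, stepProb p (s i)) * |∑ i, ((s i : ℤ) : ℝ)|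

/-- `c(k) = (1 + RW(1/6, k - 1)) / (2 k)`, for `k ≥ 1`. -/
noncomputable def boundTerm (k : ℕ) : ℝ :=
  (1 + expectedDistance (1 / 6) (k - 1)) / (2 * (k : ℝ))

end TCAM

/-!
The order of transactions is irrelevant: each lowers the vector of weights by an integer vector
with one entry `2 ^ e` and one entry `-2 ^ e` (one of them possibly at the unallocated target), so
`λ(P)` is the word length `cost P` in `ℤ ^ k`. It is subadditive, invariant under negation, and
does not grow when a vector is multiplied by a power of two.

Write `k = n + 1`. Up to a bounded error, a partition of `2 ^ W` is the vector `u` of all parts but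
one, completed by an entry that makes the total zero; `balancedCost u` is the word length of the
completed vector. For `u` uniform in the box `[0, 2 ^ W) ^ n`, low and high bits are independent,
so the mean of `balancedCost` is subadditive in `W` (`subadditive_boxMean`), and Fekete's lemma
gives a rate `boxLimit n`.

The rate is estimated through the digits of the non-adjacent form (NAF).
* Upper bound (`boxLimit_le`): at each level, positive and negative digits are paired and the excess
  is exchanged with the balancing entry. This costs `(N + |S|) / 2` transactions, where `N` is the
  number of nonzero digits at that level and `S` is their sum. The digits at a high level are
  independent and take the values `±1` with probability nearly `1 / 6` each
  (`digitCount_of_ne_zero`), so the mean cost per level tends to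
  `(n / 3 + RW(1 / 6, n)) / 2 ≤ k (1 / 6 + c(k))`.
* Lower bound (`le_boxLimit`): adding a power of two to an integer changes the number of nonzero NAF
  digits by at most one (`nafWeight_add_two_pow`), and a transaction changes at most two weights.
  Hence twice the word length is at least the number of nonzero digits of `u`, which is about
  `n W / 3` on average, and the rate is at least `n / 6`.

Ordered partitions fill a simplex rather than a box. A point of the simplex is cut into its lowest
`W - √W` bits and the remaining ones. The high bits have word length `O(√W)`, and the low bits are
nearly uniform in a box, because the number of completions of given low bits is a binomial
coefficient that hardly depends on them (`card_completions`, `tendsto_card_simplex_ratio`). So the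
mean over the simplex has the same rate (`tendsto_expectedComplexity_div`), and
`L(k) = boxLimit n / k`.

For the walk, `RW(1 / 6, n + 1) - RW(1 / 6, n)` is one third of the probability of being at the
origin after `n` steps (`expectedDistance_succ`). That probability is the mean of
`((2 + cos t) / 3) ^ n` over `[-π, π]`, and Laplace's method gives its decay
(`tendsto_sqrt_mul_returnProb`). Summation yields `RW(1 / 6, n) ~ √(2 n / (3 π))`, hence the
asymptotics of `c(k)`; in particular `c(k) → 0`, and `L(k)` is squeezed between
`(k - 1) / (6 k)` and `1 / 6 + c(k)`.
-/

namespace TCAM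

/-! ### The word length on integer vectors -/

/-- The amounts by which a transaction lowers the weights of the targets. -/
def Transaction.delta {k : ℕ} (t : Transaction k) : Fin k → ℤ :=
  fun i => (if some i = t.src then 2 ^ t.exponent else 0)
    - (if some i = t.dst then 2 ^ t.exponent else 0)

theorem foldl_apply_some {k : ℕ} (s : List (Transaction k)) (x : Option (Fin k) → ℤ) (i : Fin k) :
    s.foldl Transaction.apply x (some i) = x (some i) - (s.map Transaction.delta).sum i := by
  induction s generalizing x with
  | nil => simp
  | cons t s ih =>
    rw [List.foldl_cons, ih]
    simp only [Transaction.apply, List.map_cons, List.sum_cons, Pi.add_apply, Transaction.delta]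
    ring

/-- The least number of transactions that together lower the weights of the targets by `x`: the
word length of `x` in the group `ℤ ^ k` with respect to the effects of transactions. -/
noncomputable def cost {k : ℕ} (x : Fin k → ℤ) : ℕ :=
  sInf {n : ℕ | ∃ s : List (Transaction k), (s.map Transaction.delta).sum = x ∧ s.length = n}

theorem complexity_eq_cost {k : ℕ} (p : Fin k → ℕ) : complexity p = cost (fun i => (p i : ℤ)) := by
  unfold complexity cost
  congr 1
  ext n
  refine exists_congr fun s => and_congr_left fun _ => ?_
  simp only [Zeroes, foldl_apply_some, initialWeights, sub_eq_zero, funext_iff]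
  exact forall_congr' fun _ => eq_comm

theorem cost_le_length {k : ℕ} (s : List (Transaction k)) :
    cost (s.map Transaction.delta).sum ≤ s.length :=
  Nat.sInf_le ⟨s, rfl, rfl⟩

theorem cost_delta_le_one {k : ℕ} (t : Transaction k) : cost t.delta ≤ 1 := by
  simpa using cost_le_length [t]

theorem cost_zero {k : ℕ} : cost (0 : Fin k → ℤ) = 0 := by
  simpa using cost_le_length ([] : List (Transaction k))

theorem sum_delta_swap {k : ℕ} (s : List (Transaction k)) :
    ((s.map fun t => (⟨t.dst, t.src, t.exponent⟩ : Transaction k)).map Transaction.delta).sum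
      = -(s.map Transaction.delta).sum := by
  induction s with
  | nil => simp
  | cons t s ih =>
    rw [List.map_cons, List.map_cons, List.sum_cons, ih, List.map_cons, List.sum_cons, neg_add]
    congr 1
    ext i
    simp [Transaction.delta]

/-- The vectors that are a sum of effects of transactions form a subgroup. -/
def deltaSubgroup (k : ℕ) : AddSubgroup (Fin k → ℤ) where
  carrier := {x | ∃ s : List (Transaction k), (s.map Transaction.delta).sum = x}
  add_mem' := by
    rintro x y ⟨s, rfl⟩ ⟨t, rfl⟩
    exact ⟨s ++ t, by simp⟩
  zero_mem' := ⟨[], rfl⟩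
  neg_mem' := by
    rintro x ⟨s, rfl⟩
    exact ⟨_, sum_delta_swap s⟩

theorem exists_sum_delta {k : ℕ} (x : Fin k → ℤ) :
    ∃ s : List (Transaction k), (s.map Transaction.delta).sum = x := by
  change x ∈ deltaSubgroup k
  rw [← Finset.univ_sum_single x]
  refine sum_mem fun i _ => ?_
  have h : (Pi.single i (x i) : Fin k → ℤ) = x i • Pi.single i 1 := by
    rw [← Pi.single_smul]; simp
  have h1 : (Pi.single i 1 : Fin k → ℤ) ∈ deltaSubgroup k := by
    refine ⟨[⟨some i, none, 0⟩], ?_⟩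
    ext j
    simp [Transaction.delta, Pi.single_apply]
  rw [h]
  exact zsmul_mem h1 _

theorem exists_length_eq_cost {k : ℕ} (x : Fin k → ℤ) :
    ∃ s : List (Transaction k), (s.map Transaction.delta).sum = x ∧ s.length = cost x := by
  obtain ⟨s, hs⟩ := exists_sum_delta x
  exact Nat.sInf_mem (s := {n : ℕ | ∃ s : List (Transaction k),
    (s.map Transaction.delta).sum = x ∧ s.length = n}) ⟨_, s, hs, rfl⟩

theorem cost_add_le {k : ℕ} (x y : Fin k → ℤ) : cost (x + y) ≤ cost x + cost y := by
  obtain ⟨s, rfl, hs⟩ := exists_length_eq_cost x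
  obtain ⟨t, rfl, ht⟩ := exists_length_eq_cost y
  rw [← hs, ← ht, ← List.length_append, ← List.sum_append, ← List.map_append]
  exact cost_le_length _

theorem cost_neg_le {k : ℕ} (x : Fin k → ℤ) : cost (-x) ≤ cost x := by
  obtain ⟨s, rfl, hs⟩ := exists_length_eq_cost x
  rw [← hs, ← sum_delta_swap]
  exact (cost_le_length _).trans (by simp)

theorem cost_le_cost_add {k : ℕ} (x y : Fin k → ℤ) : cost x ≤ cost (x + y) + cost y := by
  have h := cost_add_le (x + y) (-y)
  have h' := cost_neg_le y
  rw [add_neg_cancel_right] at h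
  omega

theorem cost_two_pow_smul_le {k : ℕ} (V : ℕ) (x : Fin k → ℤ) :
    cost ((2 ^ V : ℤ) • x) ≤ cost x := by
  obtain ⟨s, rfl, hs⟩ := exists_length_eq_cost x
  have h : ((s.map fun t => (⟨t.src, t.dst, V + t.exponent⟩ : Transaction k)).map
      Transaction.delta).sum = (2 ^ V : ℤ) • (s.map Transaction.delta).sum := by
    clear hs
    induction s with
    | nil => simp
    | cons t s ih =>
      rw [List.map_cons, List.map_cons, List.sum_cons, ih, List.map_cons, List.sum_cons, smul_add]
      congr 1
      ext i
      simp [Transaction.delta, pow_add, mul_sub]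
  rw [← hs, ← h]
  exact (cost_le_length _).trans (by simp)

/-- The vector `u` preceded by the entry that makes the sum of all entries zero. -/
def balance {n : ℕ} (u : Fin n → ℤ) : Fin (n + 1) → ℤ := Fin.cons (-∑ i, u i) u

theorem balance_add {n : ℕ} (u v : Fin n → ℤ) : balance (u + v) = balance u + balance v := by
  ext i
  refine Fin.cases ?_ (fun i => ?_) i
  · simp [balance, Finset.sum_add_distrib]; ring
  · simp [balance]

theorem balance_zsmul {n : ℕ} (c : ℤ) (u : Fin n → ℤ) : balance (c • u) = c • balance u := by
  ext i
  refine Fin.cases ?_ (fun i => ?_) i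
  · simp [balance, Finset.mul_sum]
  · simp [balance]

theorem balance_zero {n : ℕ} : balance (0 : Fin n → ℤ) = 0 := by
  simpa using balance_zsmul 0 (0 : Fin n → ℤ)

/-- The word length of `u ∈ ℤ ^ n`, completed by one balancing entry. -/
noncomputable def balancedCost {n : ℕ} (u : Fin n → ℤ) : ℕ := cost (balance u)

theorem balancedCost_zero {n : ℕ} : balancedCost (0 : Fin n → ℤ) = 0 := by
  rw [balancedCost, balance_zero, cost_zero]

theorem balancedCost_add_le {n : ℕ} (u v : Fin n → ℤ) :
    balancedCost (u + v) ≤ balancedCost u + balancedCost v := by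
  rw [balancedCost, balance_add]; exact cost_add_le _ _

theorem balancedCost_le_add {n : ℕ} (u v : Fin n → ℤ) :
    balancedCost u ≤ balancedCost (u + v) + balancedCost v := by
  unfold balancedCost
  rw [balance_add]; exact cost_le_cost_add _ _

theorem balancedCost_two_pow_smul_le {n : ℕ} (V : ℕ) (u : Fin n → ℤ) :
    balancedCost ((2 ^ V : ℤ) • u) ≤ balancedCost u := by
  rw [balancedCost, balance_zsmul]; exact cost_two_pow_smul_le _ _

/-- The coordinate vector of an index, or zero. -/
def unitVec {n : ℕ} : Option (Fin n) → Fin n → ℤ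
  | none => 0
  | some i => Pi.single i 1

theorem balancedCost_unitVec_sub_le {n : ℕ} (a b : Option (Fin n)) :
    balancedCost (unitVec a - unitVec b) ≤ 1 := by
  -- The balancing entry takes the place of a missing index.
  have h : balance (unitVec a - unitVec b) = Transaction.delta
      ⟨some (a.elim 0 Fin.succ), some (b.elim 0 Fin.succ), 0⟩ := by
    ext i
    refine Fin.cases ?_ (fun i => ?_) i <;> rcases a with _ | a <;> rcases b with _ | b <;>
      simp [balance, unitVec, Transaction.delta, Pi.single_apply, Finset.sum_sub_distrib,
        Fin.succ_ne_zero, (Fin.succ_ne_zero _).symm]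
  rw [balancedCost, h]
  exact cost_delta_le_one _

/-- Units of opposite sign are moved in pairs, and left-over units are exchanged with the
balancing entry. -/
theorem balancedCost_le_of_card_le {n : ℕ} (m : ℕ) (s : Fin n → SignType)
    (hp : (Finset.univ.filter fun i => s i = 1).card ≤ m)
    (hq : (Finset.univ.filter fun i => s i = -1).card ≤ m) :
    balancedCost (fun i => (s i : ℤ)) ≤ m := by
  induction m generalizing s with
  | zero =>
    simp only [Nat.le_zero, Finset.card_eq_zero, Finset.filter_eq_empty_iff, Finset.mem_univ,
      true_imp_iff] at hp hq
    have : (fun i => (s i : ℤ)) = 0 := by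
      ext i
      have h1 := @hp i
      have h2 := @hq i
      revert h1 h2
      rcases s i <;> simp
    rw [this, balancedCost_zero]
  | succ m ih =>
    have key : ∀ c : SignType, (Finset.univ.filter fun i => s i = c).card ≤ m + 1 →
        ∃ a : Option (Fin n), (∀ i, a = some i → s i = c) ∧
          (Finset.univ.filter fun i => s i = c ∧ a ≠ some i).card ≤ m := by
      intro c hc
      rcases (Finset.univ.filter fun i => s i = c).eq_empty_or_nonempty with h0 | ⟨j, hj⟩
      · refine ⟨none, by simp, ?_⟩
        simp [h0]
      · refine ⟨some j, ?_, ?_⟩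
        · rintro i hi; cases hi; simpa using hj
        · have : (Finset.univ.filter fun i => s i = c ∧ some j ≠ some i)
              = (Finset.univ.filter fun i => s i = c).erase j := by
            ext i; simp [and_comm, eq_comm]
          rw [this, Finset.card_erase_of_mem hj]; omega
    obtain ⟨a, ha, ha'⟩ := key 1 hp
    obtain ⟨b, hb, hb'⟩ := key (-1) hq
    let s' : Fin n → SignType := fun i => if a = some i ∨ b = some i then 0 else s i
    have hs : (fun i => (s i : ℤ)) = (fun i => (s' i : ℤ)) + (unitVec a - unitVec b) := by
      ext i
      have h1 : unitVec a i = if a = some i then 1 else 0 := by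
        rcases a with _ | a <;> simp [unitVec, Pi.single_apply, eq_comm]
      have h2 : unitVec b i = if b = some i then 1 else 0 := by
        rcases b with _ | b <;> simp [unitVec, Pi.single_apply, eq_comm]
      have h3 := ha i
      have h4 := hb i
      simp only [Pi.add_apply, Pi.sub_apply, h1, h2, s']
      by_cases h5 : a = some i <;> by_cases h6 : b = some i <;> simp_all
    have hle := ih s'
      ((Finset.card_le_card fun i => by
        simp only [Finset.mem_filter, Finset.mem_univ, true_and, s']
        split_ifs <;> simp_all).trans ha')
      ((Finset.card_le_card fun i => by
        simp only [Finset.mem_filter, Finset.mem_univ, true_and, s']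
        split_ifs <;> simp_all).trans hb')
    rw [hs]
    exact (balancedCost_add_le _ _).trans
      (add_le_add hle (balancedCost_unitVec_sub_le a b))

/-! ### Signed binary digits -/

/-- The lowest digit of the non-adjacent form of an integer: the representative in `{-1, 0, 1}`
that leaves an even quotient when the integer is odd. -/
def lowDigit (z : ℤ) : SignType := if z % 4 = 1 then 1 else if z % 4 = 3 then -1 else 0

/-- The integer left after the lowest non-adjacent digit is removed. -/
def dropDigit (z : ℤ) : ℤ := (z - lowDigit z) / 2

/-- The `l`-th digit of the non-adjacent form of an integer. -/
def nafDigit (z : ℤ) (l : ℕ) : SignType := lowDigit (dropDigit^[l] z)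

/-- The number of nonzero digits among the lowest `L` digits of the non-adjacent form. -/
def nafWeight (L : ℕ) (z : ℤ) : ℕ := ∑ l ∈ Finset.range L, if nafDigit z l = 0 then 0 else 1

theorem lowDigit_two_mul (y : ℤ) : lowDigit (2 * y) = 0 := by
  unfold lowDigit; rw [if_neg (by omega), if_neg (by omega)]

theorem lowDigit_four_mul_add_one (x : ℤ) : lowDigit (4 * x + 1) = 1 := by
  unfold lowDigit; rw [if_pos (by omega)]

theorem lowDigit_four_mul_add_three (x : ℤ) : lowDigit (4 * x + 3) = -1 := by
  unfold lowDigit; rw [if_neg (by omega), if_pos (by omega)]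

theorem dropDigit_two_mul (y : ℤ) : dropDigit (2 * y) = y := by
  unfold dropDigit; rw [lowDigit_two_mul]; simp

theorem dropDigit_four_mul_add_one (x : ℤ) : dropDigit (4 * x + 1) = 2 * x := by
  unfold dropDigit; rw [lowDigit_four_mul_add_one]; simp; omega

theorem dropDigit_four_mul_add_three (x : ℤ) : dropDigit (4 * x + 3) = 2 * (x + 1) := by
  unfold dropDigit; rw [lowDigit_four_mul_add_three]; simp; omega

theorem even_or_mod_four (z : ℤ) :
    (∃ y, z = 2 * y) ∨ (∃ x, z = 4 * x + 1) ∨ ∃ x, z = 4 * x + 3 := by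
  have h : z % 2 = 0 ∨ z % 4 = 1 ∨ z % 4 = 3 := by omega
  rcases h with h | h | h
  · exact .inl ⟨z / 2, by omega⟩
  · exact .inr (.inl ⟨z / 4, by omega⟩)
  · exact .inr (.inr ⟨z / 4, by omega⟩)

theorem lowDigit_add_two_mul_dropDigit (z : ℤ) : (lowDigit z : ℤ) + 2 * dropDigit z = z := by
  rcases even_or_mod_four z with ⟨y, rfl⟩ | ⟨x, rfl⟩ | ⟨x, rfl⟩
  · simp [lowDigit_two_mul, dropDigit_two_mul]
  · simp [lowDigit_four_mul_add_one, dropDigit_four_mul_add_one]; ring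
  · simp [lowDigit_four_mul_add_three, dropDigit_four_mul_add_three]; ring

theorem nafDigit_zero_right (z : ℤ) : nafDigit z 0 = lowDigit z := rfl

theorem nafDigit_succ (z : ℤ) (l : ℕ) : nafDigit z (l + 1) = nafDigit (dropDigit z) l := rfl

theorem nafWeight_zero_left (z : ℤ) : nafWeight 0 z = 0 := rfl

theorem nafWeight_succ (L : ℕ) (z : ℤ) :
    nafWeight (L + 1) z = (if lowDigit z = 0 then 0 else 1) + nafWeight L (dropDigit z) := by
  rw [nafWeight, Finset.sum_range_succ', add_comm]
  rfl

theorem nafWeight_two_mul (L : ℕ) (y : ℤ) : nafWeight (L + 1) (2 * y) = nafWeight L y := by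
  rw [nafWeight_succ, lowDigit_two_mul, dropDigit_two_mul]; simp

theorem nafWeight_four_mul_add_one (L : ℕ) (x : ℤ) :
    nafWeight (L + 2) (4 * x + 1) = 1 + nafWeight L x := by
  rw [nafWeight_succ, lowDigit_four_mul_add_one, dropDigit_four_mul_add_one, nafWeight_two_mul]
  simp

theorem nafWeight_four_mul_add_three (L : ℕ) (x : ℤ) :
    nafWeight (L + 2) (4 * x + 3) = 1 + nafWeight L (x + 1) := by
  rw [nafWeight_succ, lowDigit_four_mul_add_three, dropDigit_four_mul_add_three,
    nafWeight_two_mul]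
  simp

theorem nafWeight_one_le (z : ℤ) : nafWeight 1 z ≤ 1 := by
  rw [nafWeight_succ, nafWeight_zero_left]; split_ifs <;> simp

/-- An odd integer `2 x + 1` has one nonzero digit more than one of its neighbours `2 x`, `2 x + 2`. -/
theorem nafWeight_odd (L : ℕ) (x : ℤ) :
    nafWeight (L + 1) (2 * x + 1) = 1 + nafWeight L x ∨
      nafWeight (L + 1) (2 * x + 1) = 1 + nafWeight L (x + 1) := by
  obtain ⟨v, rfl | rfl⟩ : ∃ v, x = 2 * v ∨ x = 2 * v + 1 := ⟨x / 2, by omega⟩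
  · left
    rw [show 2 * (2 * v) + 1 = 4 * v + 1 by ring]
    rcases L with _ | L
    · rw [nafWeight_succ, lowDigit_four_mul_add_one]; simp [nafWeight_zero_left]
    · rw [nafWeight_four_mul_add_one, nafWeight_two_mul]
  · right
    rw [show 2 * (2 * v + 1) + 1 = 4 * v + 3 by ring,
      show 2 * v + 1 + 1 = 2 * (v + 1) by ring]
    rcases L with _ | L
    · rw [nafWeight_succ, lowDigit_four_mul_add_three]; simp [nafWeight_zero_left]
    · rw [nafWeight_four_mul_add_three, nafWeight_two_mul]

/-- Adding or subtracting a power of two changes the weight of the non-adjacent form by at most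
one. This is what makes the non-adjacent form a shortest signed binary representation. -/
theorem nafWeight_add_two_pow (L : ℕ) (z : ℤ) (e : ℕ) :
    nafWeight L (z + 2 ^ e) ≤ nafWeight L z + 1 ∧
      nafWeight L z ≤ nafWeight L (z + 2 ^ e) + 1 := by
  induction L using Nat.strong_induction_on generalizing z e with
  | _ L ih =>
  rcases L with _ | _ | L
  · simp [nafWeight_zero_left]
  · have h1 := nafWeight_one_le z
    have h2 := nafWeight_one_le (z + 2 ^ e)
    simp only [zero_add]
    omega
  · rcases e with _ | _ | e
    · rw [pow_zero]
      obtain ⟨x, rfl | rfl | rfl | rfl⟩ :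
          ∃ x, z = 4 * x ∨ z = 4 * x + 1 ∨ z = 4 * x + 2 ∨ z = 4 * x + 3 :=
        ⟨z / 4, by omega⟩
      all_goals
        have h1 := ih L (by omega) x 0
        have h2 := nafWeight_odd L x
        have h3 : nafWeight (L + 2) (4 * x) = nafWeight L x := by
          rw [show 4 * x = 2 * (2 * x) by ring, nafWeight_two_mul, nafWeight_two_mul]
        have h4 := nafWeight_four_mul_add_one L x
        have h5 : nafWeight (L + 2) (4 * x + 2) = nafWeight (L + 1) (2 * x + 1) := by
          rw [show 4 * x + 2 = 2 * (2 * x + 1) by ring, nafWeight_two_mul]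
        have h6 := nafWeight_four_mul_add_three L x
        have h7 : nafWeight (L + 2) (4 * x + 3 + 1) = nafWeight L (x + 1) := by
          rw [show 4 * x + 3 + 1 = 2 * (2 * (x + 1)) by ring, nafWeight_two_mul,
            nafWeight_two_mul]
        have h8 : 4 * x + 1 + 1 = 4 * x + 2 := by ring
        have h9 : 4 * x + 2 + 1 = 4 * x + 3 := by ring
        rw [pow_zero] at h1
        simp only [add_assoc, one_add_one_eq_two, h8, h9] at *
        omega
    · rcases even_or_mod_four z with ⟨y, rfl⟩ | ⟨x, rfl⟩ | ⟨x, rfl⟩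
      · have h := ih (L + 1) (by omega) y 0
        rw [show 2 * y + 2 ^ (0 + 1) = 2 * (y + 2 ^ 0) by ring, nafWeight_two_mul,
          nafWeight_two_mul]
        exact h
      · have h := ih L (by omega) x 0
        rw [show 4 * x + 1 + 2 ^ (0 + 1) = 4 * x + 3 by ring, nafWeight_four_mul_add_one,
          nafWeight_four_mul_add_three]
        rw [pow_zero] at h
        omega
      · rw [show 4 * x + 3 + 2 ^ (0 + 1) = 4 * (x + 1) + 1 by ring, nafWeight_four_mul_add_one,
          nafWeight_four_mul_add_three]
        omega
    · rcases even_or_mod_four z with ⟨y, rfl⟩ | ⟨x, rfl⟩ | ⟨x, rfl⟩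
      · have h := ih (L + 1) (by omega) y (e + 1)
        rw [show 2 * y + 2 ^ (e + 1 + 1) = 2 * (y + 2 ^ (e + 1)) by ring, nafWeight_two_mul,
          nafWeight_two_mul]
        exact h
      · have h := ih L (by omega) x e
        rw [show 4 * x + 1 + 2 ^ (e + 1 + 1) = 4 * (x + 2 ^ e) + 1 by ring,
          nafWeight_four_mul_add_one, nafWeight_four_mul_add_one]
        omega
      · have h := ih L (by omega) (x + 1) e
        rw [show 4 * x + 3 + 2 ^ (e + 1 + 1) = 4 * (x + 2 ^ e) + 3 by ring,
          nafWeight_four_mul_add_three, nafWeight_four_mul_add_three,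
          show x + 2 ^ e + 1 = x + 1 + 2 ^ e by ring]
        omega

theorem nafWeight_zero_right (L : ℕ) : nafWeight L 0 = 0 := by
  induction L with
  | zero => rfl
  | succ L ih => rw [← mul_zero 2, nafWeight_two_mul, ih]

/-- A transaction touches at most two weights, and changes the weight of each non-adjacent form
by at most one. -/
theorem sum_nafWeight_add_delta_le {k : ℕ} (L : ℕ) (t : Transaction k) (x : Fin k → ℤ) :
    ∑ i, nafWeight L ((t.delta + x) i) ≤ ∑ i, nafWeight L (x i) + 2 := by
  have hcard : ∀ a : Option (Fin k), ∑ i, (if some i = a then 1 else 0) ≤ 1 := by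
    rintro (_ | a) <;> simp
  calc ∑ i, nafWeight L ((t.delta + x) i)
      ≤ ∑ i, (nafWeight L (x i) + ((if some i = t.src then 1 else 0)
          + (if some i = t.dst then 1 else 0))) := by
        refine Finset.sum_le_sum fun i _ => ?_
        have h1 := (nafWeight_add_two_pow L (x i) t.exponent).1
        have h2 := (nafWeight_add_two_pow L (x i - 2 ^ t.exponent) t.exponent).2
        rw [sub_add_cancel] at h2
        simp only [Pi.add_apply, Transaction.delta]
        split_ifs
        · simp
        · rw [sub_zero, add_comm]; exact h1
        · rw [zero_sub, neg_add_eq_sub]; exact h2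
        · simp
    _ ≤ ∑ i, nafWeight L (x i) + 2 := by
        rw [Finset.sum_add_distrib, Finset.sum_add_distrib]
        have h1 := hcard t.src
        have h2 := hcard t.dst
        omega

theorem sum_nafWeight_le_two_mul_cost {k : ℕ} (L : ℕ) (x : Fin k → ℤ) :
    ∑ i, nafWeight L (x i) ≤ 2 * cost x := by
  obtain ⟨s, rfl, hs⟩ := exists_length_eq_cost x
  rw [← hs]
  clear hs
  induction s with
  | nil => simp [nafWeight_zero_right]
  | cons t s ih =>
    rw [List.map_cons, List.sum_cons, List.length_cons]
    have := sum_nafWeight_add_delta_le L t (s.map Transaction.delta).sum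
    omega

theorem sum_nafWeight_le_two_mul_balancedCost {n : ℕ} (L : ℕ) (u : Fin n → ℤ) :
    ∑ i, nafWeight L (u i) ≤ 2 * balancedCost u := by
  have h := sum_nafWeight_le_two_mul_cost L (balance u)
  rw [Fin.sum_univ_succ] at h
  simp only [balance, Fin.cons_succ] at h
  exact le_of_add_le_right h

/-- The number of transactions that remove one level of digits: the larger of the numbers of
positive and of negative digits. -/
def levelCost {n : ℕ} (s : Fin n → SignType) : ℕ :=
  max (Finset.univ.filter fun i => s i = 1).card (Finset.univ.filter fun i => s i = -1).card

theorem levelCost_le {n : ℕ} (s : Fin n → SignType) : levelCost s ≤ n :=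
  max_le ((Finset.card_filter_le _ _).trans (by simp))
    ((Finset.card_filter_le _ _).trans (by simp))

theorem levelCost_eq {n : ℕ} (s : Fin n → SignType) :
    (levelCost s : ℝ) = ((∑ i, |((s i : ℤ) : ℝ)|) + |∑ i, ((s i : ℤ) : ℝ)|) / 2 := by
  have h1 : ∑ i, |((s i : ℤ) : ℝ)| = ((Finset.univ.filter fun i => s i = 1).card : ℝ)
      + ((Finset.univ.filter fun i => s i = -1).card : ℝ) := by
    simp only [Finset.card_filter, Nat.cast_sum, ← Finset.sum_add_distrib]
    refine Finset.sum_congr rfl fun i _ => ?_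
    rcases s i <;> simp
  have h2 : ∑ i, ((s i : ℤ) : ℝ) = ((Finset.univ.filter fun i => s i = 1).card : ℝ)
      - ((Finset.univ.filter fun i => s i = -1).card : ℝ) := by
    simp only [Finset.card_filter, Nat.cast_sum, ← Finset.sum_sub_distrib]
    refine Finset.sum_congr rfl fun i _ => ?_
    rcases s i <;> simp
  rw [h1, h2, levelCost, Nat.cast_max]
  rcases le_total ((Finset.univ.filter fun i => s i = 1).card : ℝ)
    ((Finset.univ.filter fun i => s i = -1).card : ℝ) with h | h
  · rw [max_eq_right h, abs_of_nonpos (by linarith)]; ring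
  · rw [max_eq_left h, abs_of_nonneg (by linarith)]; ring

theorem balancedCost_le_levelCost_add {n : ℕ} (u : Fin n → ℤ) :
    balancedCost u ≤ levelCost (fun i => lowDigit (u i))
      + balancedCost (fun i => dropDigit (u i)) := by
  have h : u = (fun i => (lowDigit (u i) : ℤ)) + (2 ^ 1 : ℤ) • fun i => dropDigit (u i) := by
    ext i
    simpa using (lowDigit_add_two_mul_dropDigit (u i)).symm
  conv_lhs => rw [h]
  exact (balancedCost_add_le _ _).trans (add_le_add
    (balancedCost_le_of_card_le _ _ (le_max_left _ _) (le_max_right _ _))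
    (balancedCost_two_pow_smul_le _ _))

theorem dropDigit_mem {L : ℕ} {z : ℤ} (h0 : 0 ≤ z) (h1 : z ≤ 2 ^ (L + 1)) :
    0 ≤ dropDigit z ∧ dropDigit z ≤ 2 ^ L := by
  rw [pow_succ] at h1
  rcases even_or_mod_four z with ⟨y, rfl⟩ | ⟨x, rfl⟩ | ⟨x, rfl⟩
  · rw [dropDigit_two_mul]; omega
  · rw [dropDigit_four_mul_add_one]; omega
  · rw [dropDigit_four_mul_add_three]; omega

/-- Removing the digits of `u` level by level, at each level by the cheapest set of transactions,
and the remaining vector of zeros and ones by single transactions. -/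
theorem balancedCost_le_sum_levelCost {n : ℕ} (L : ℕ) (u : Fin n → ℤ)
    (h0 : ∀ i, 0 ≤ u i) (h1 : ∀ i, u i ≤ 2 ^ L) :
    balancedCost u ≤ ∑ l ∈ Finset.range L, levelCost (fun i => nafDigit (u i) l) + n := by
  induction L generalizing u with
  | zero =>
    have h : u = fun i => ((if u i = 1 then 1 else 0 : SignType) : ℤ) := by
      ext i
      have := h0 i
      have := h1 i
      split_ifs <;> simp <;> omega
    rw [h, Finset.range_zero, Finset.sum_empty, zero_add]
    exact balancedCost_le_of_card_le _ _ ((Finset.card_filter_le _ _).trans (by simp))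
      ((Finset.card_filter_le _ _).trans (by simp))
  | succ L ih =>
    have h := ih (fun i => dropDigit (u i)) (fun i => (dropDigit_mem (h0 i) (h1 i)).1)
      (fun i => (dropDigit_mem (h0 i) (h1 i)).2)
    rw [Finset.sum_range_succ']
    simp only [nafDigit_succ, nafDigit_zero_right]
    have h' := balancedCost_le_levelCost_add u
    omega

theorem balancedCost_le_mul {n : ℕ} (L : ℕ) (u : Fin n → ℤ)
    (h0 : ∀ i, 0 ≤ u i) (h1 : ∀ i, u i ≤ 2 ^ L) : balancedCost u ≤ (L + 1) * n := by
  refine (balancedCost_le_sum_levelCost L u h0 h1).trans ?_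
  have := Finset.sum_le_card_nsmul (Finset.range L)
    (fun l => levelCost (fun i => nafDigit (u i) l)) n (fun l _ => levelCost_le _)
  rw [Finset.card_range, smul_eq_mul] at this
  linarith

/-! ### The distribution of the digits -/

/-- The vectors of `n` natural numbers below `2 ^ W`. -/
def box (n W : ℕ) : Finset (Fin n → ℕ) := Fintype.piFinset fun _ => Finset.range (2 ^ W)

theorem mem_box {n W : ℕ} {u : Fin n → ℕ} : u ∈ box n W ↔ ∀ i, u i < 2 ^ W := by
  simp [box]

theorem card_box (n W : ℕ) : (box n W).card = (2 ^ W) ^ n := by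
  simp [box]

theorem dropDigit_add_two_pow_mul (W : ℕ) (z c : ℤ) :
    lowDigit (z + 2 ^ (W + 2) * c) = lowDigit z ∧
      dropDigit (z + 2 ^ (W + 2) * c) = dropDigit z + 2 ^ (W + 1) * c := by
  have h : lowDigit (z + 2 ^ (W + 2) * c) = lowDigit z := by
    have : (z + 2 ^ (W + 2) * c) % 4 = z % 4 := by
      rw [pow_add, mul_comm (2 ^ W : ℤ), mul_assoc]; norm_num
    simp only [lowDigit, this]
  refine ⟨h, ?_⟩
  have h1 := lowDigit_add_two_mul_dropDigit (z + 2 ^ (W + 2) * c)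
  have h2 := lowDigit_add_two_mul_dropDigit z
  rw [h] at h1
  have h3 : (2 : ℤ) ^ (W + 2) * c = 2 * (2 ^ (W + 1) * c) := by ring
  omega

theorem nafDigit_add_two_pow_mul (l W : ℕ) (h : l + 2 ≤ W) (z c : ℤ) :
    nafDigit (z + 2 ^ W * c) l = nafDigit z l := by
  induction l generalizing W z with
  | zero =>
    obtain ⟨W, rfl⟩ := Nat.exists_eq_add_of_le' h
    exact (dropDigit_add_two_pow_mul W z c).1
  | succ l ih =>
    obtain ⟨W, rfl⟩ := Nat.exists_eq_add_of_le' (show 2 ≤ W by omega)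
    rw [nafDigit_succ, nafDigit_succ, (dropDigit_add_two_pow_mul W z c).2]
    exact ih (W + 1) (by omega) _

theorem sum_range_two_mul (N : ℕ) (f : ℕ → ℝ) :
    ∑ z ∈ Finset.range (2 * N), f z = ∑ x ∈ Finset.range N, (f (2 * x) + f (2 * x + 1)) := by
  induction N with
  | zero => simp
  | succ N ih =>
    rw [show 2 * (N + 1) = 2 * N + 1 + 1 by ring, Finset.sum_range_succ, Finset.sum_range_succ, ih,
      Finset.sum_range_succ]
    ring

theorem sum_range_four_mul (N : ℕ) (f : ℕ → ℝ) :
    ∑ z ∈ Finset.range (2 * (2 * N)), f z = ∑ x ∈ Finset.range N,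
      (f (4 * x) + f (4 * x + 1) + f (4 * x + 2) + f (4 * x + 3)) := by
  rw [sum_range_two_mul, sum_range_two_mul]
  refine Finset.sum_congr rfl fun x _ => ?_
  ring_nf

/-- The number of integers in `[0, 2 ^ W)` whose `l`-th digit is `c`. -/
noncomputable def digitCount (W l : ℕ) (c : SignType) : ℝ :=
  ∑ z ∈ Finset.range (2 ^ W), if nafDigit (z : ℤ) l = c then 1 else 0

theorem digitCount_zero (W : ℕ) {c : SignType} (hc : c ≠ 0) :
    digitCount (W + 2) 0 c = 2 ^ W := by
  rw [digitCount, show 2 ^ (W + 2) = 2 * (2 * 2 ^ W) by ring, sum_range_four_mul]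
  simp only [nafDigit_zero_right]
  rw [Finset.sum_congr rfl (g := fun _ => (1 : ℝ)) fun x _ => ?_]
  · simp
  · push_cast
    rw [lowDigit_four_mul_add_one, lowDigit_four_mul_add_three,
      show (4 * x : ℤ) = 2 * (2 * x) by ring,
      show (2 * (2 * x) + 2 : ℤ) = 2 * (2 * x + 1) by ring, lowDigit_two_mul, lowDigit_two_mul]
    rcases c
    · exact absurd rfl hc
    · simp
    · simp

/-- Half of the integers are even, and then dropping the lowest digit gives a uniformly
distributed integer; it gives a uniformly distributed even integer otherwise. -/
theorem digitCount_succ (W l : ℕ) (h : l + 1 ≤ W) (c : SignType) :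
    digitCount (W + 2) (l + 1) c = digitCount (W + 1) l c
      + 2 * ∑ x ∈ Finset.range (2 ^ W), if nafDigit (2 * x : ℤ) l = c then 1 else 0 := by
  -- By periodicity of the digit, the odd residues `4 x + 1` and `4 x + 3` contribute the same.
  have hshift : ∑ x ∈ Finset.range (2 ^ W), (if nafDigit (2 * (x + 1 : ℤ)) l = c then 1 else 0)
      = ∑ x ∈ Finset.range (2 ^ W), (if nafDigit (2 * x : ℤ) l = c then 1 else (0 : ℝ)) := by
    have h1 := Finset.sum_range_succ
      (fun x : ℕ => if nafDigit (2 * x : ℤ) l = c then 1 else (0 : ℝ)) (2 ^ W)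
    have h2 := Finset.sum_range_succ'
      (fun x : ℕ => if nafDigit (2 * x : ℤ) l = c then 1 else (0 : ℝ)) (2 ^ W)
    have h3 : nafDigit (2 * 2 ^ W : ℤ) l = nafDigit 0 l := by
      have := nafDigit_add_two_pow_mul l (W + 1) (by omega) 0 1
      rwa [zero_add, mul_one, pow_succ, mul_comm] at this
    push_cast at h1 h2
    rw [h3] at h1
    linarith
  unfold digitCount
  rw [show 2 ^ (W + 2) = 2 * (2 * 2 ^ W) by ring, sum_range_four_mul,
    show 2 ^ (W + 1) = 2 * 2 ^ W by ring, sum_range_two_mul, two_mul (∑ x ∈ _, _)]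
  nth_rw 2 [← hshift]
  rw [← Finset.sum_add_distrib, ← Finset.sum_add_distrib]
  refine Finset.sum_congr rfl fun x _ => ?_
  push_cast
  rw [nafDigit_succ, nafDigit_succ, nafDigit_succ, nafDigit_succ, dropDigit_four_mul_add_one,
    dropDigit_four_mul_add_three, show (4 * x : ℤ) = 2 * (2 * x) by ring,
    show (2 * (2 * x) + 2 : ℤ) = 2 * (2 * x + 1) by ring, dropDigit_two_mul, dropDigit_two_mul]
  ring

/-- The probability that the `l`-th digit of a uniformly random integer in `[0, 2 ^ W)` is `1`, for
`l + 2 ≤ W`; it is also the probability of `-1`. It solves `p (l + 2) = (p (l + 1) + p l) / 2`. -/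
noncomputable def digitProb (l : ℕ) : ℝ := 1 / 6 + (-1 / 2) ^ l / 12

theorem digitCount_of_ne_zero (l W : ℕ) (h : l + 2 ≤ W) {c : SignType} (hc : c ≠ 0) :
    digitCount W l c = 2 ^ W * digitProb l := by
  induction l using Nat.strong_induction_on generalizing W with
  | _ l ih =>
  obtain ⟨W, rfl⟩ := Nat.exists_eq_add_of_le' (show 2 ≤ W by omega)
  rcases l with _ | l
  · rw [digitCount_zero W hc, digitProb, pow_add]; norm_num; ring
  · rw [digitCount_succ W l (by omega), ih l (by omega) (W + 1) (by omega)]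
    rcases l with _ | l
    · simp only [nafDigit_zero_right, lowDigit_two_mul, hc.symm, if_false, Finset.sum_const_zero]
      simp only [digitProb]; ring
    · simp only [nafDigit_succ, dropDigit_two_mul]
      have := ih l (by omega) W (by omega)
      rw [digitCount] at this
      rw [this]
      simp only [digitProb]; ring

theorem sum_digitCount (W l : ℕ) :
    digitCount W l 0 + digitCount W l 1 + digitCount W l (-1) = 2 ^ W := by
  simp only [digitCount, ← Finset.sum_add_distrib]
  rw [Finset.sum_congr rfl (g := fun _ => (1 : ℝ)) fun x _ => ?_]
  · simp
  · rcases nafDigit (x : ℤ) l <;> simp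

theorem digitCount_eq (l W : ℕ) (h : l + 2 ≤ W) (c : SignType) :
    digitCount W l c = 2 ^ W * stepProb (digitProb l) c := by
  rcases eq_or_ne c 0 with rfl | hc
  · have h0 := sum_digitCount W l
    rw [digitCount_of_ne_zero l W h one_ne_zero,
      digitCount_of_ne_zero l W h (c := -1) (by decide)] at h0
    rw [stepProb, if_pos rfl]
    linarith
  · rw [digitCount_of_ne_zero l W h hc, stepProb, if_neg hc]

theorem tendsto_digitProb : Tendsto digitProb atTop (𝓝 (1 / 6)) := by
  have h := tendsto_pow_atTop_nhds_zero_of_abs_lt_one (r := (-1 / 2 : ℝ)) (by norm_num [abs_lt])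
  have h' := (h.div_const 12).const_add (1 / 6)
  rwa [zero_div, add_zero] at h'

/-- The expectation of `H` when the `n` signs are independent with law `stepProb p`. -/
noncomputable def stepMean {n : ℕ} (p : ℝ) (H : (Fin n → SignType) → ℝ) : ℝ :=
  ∑ s, (∏ i, stepProb p (s i)) * H s

/-- The `l`-th digits of the entries of a uniformly random vector are independent. -/
theorem sum_box_nafDigit {n : ℕ} (l W : ℕ) (h : l + 2 ≤ W) (H : (Fin n → SignType) → ℝ) :
    ∑ u ∈ box n W, H (fun i => nafDigit (u i) l) = (2 ^ W) ^ n * stepMean (digitProb l) H := by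
  have hcard : ∀ s : Fin n → SignType,
      (((box n W).filter fun u => (fun i => nafDigit (u i) l) = s).card : ℝ)
        = (2 ^ W) ^ n * ∏ i, stepProb (digitProb l) (s i) := by
    intro s
    have : ((box n W).filter fun u => (fun i => nafDigit (u i) l) = s)
        = Fintype.piFinset fun i =>
          (Finset.range (2 ^ W)).filter fun z : ℕ => nafDigit (z : ℤ) l = s i := by
      ext u
      simp [mem_box, funext_iff, forall_and]
    rw [this, Fintype.card_piFinset, Nat.cast_prod]
    have h2 : ∀ i, (((Finset.range (2 ^ W)).filter fun z : ℕ => nafDigit (z : ℤ) l = s i).card : ℝ)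
        = 2 ^ W * stepProb (digitProb l) (s i) := by
      intro i
      rw [← digitCount_eq l W h, digitCount, Finset.sum_boole]
    rw [Finset.prod_congr rfl fun i _ => h2 i, Finset.prod_mul_distrib]
    simp
  rw [← Finset.sum_fiberwise (box n W) (fun u i => nafDigit (u i) l), stepMean, Finset.mul_sum]
  refine Finset.sum_congr rfl fun s _ => ?_
  rw [Finset.sum_congr rfl (g := fun _ => H s), Finset.sum_const, nsmul_eq_mul, hcard, mul_assoc]
  intro u hu
  rw [(Finset.mem_filter.1 hu).2]

theorem tendsto_stepMean {n : ℕ} (H : (Fin n → SignType) → ℝ) :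
    Tendsto (fun l => stepMean (digitProb l) H) atTop (𝓝 (stepMean (1 / 6) H)) := by
  have hc : Continuous fun p : ℝ => stepMean p H := by
    unfold stepMean stepProb
    refine continuous_finsetSum _ fun s _ => (continuous_finsetProd _ fun i _ => ?_).mul
      continuous_const
    split_ifs <;> fun_prop
  exact (hc.tendsto _).comp tendsto_digitProb

theorem sum_stepProb_mul (p : ℝ) (f : SignType → ℝ) :
    ∑ c, stepProb p c * f c = (1 - 2 * p) * f 0 + p * f 1 + p * f (-1) := by
  have : (Finset.univ : Finset SignType) = {0, 1, -1} := by decide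
  rw [this, Finset.sum_insert (by decide), Finset.sum_insert (by decide), Finset.sum_singleton]
  simp [stepProb]
  ring

theorem stepMean_succ {n : ℕ} (p : ℝ) (H : (Fin (n + 1) → SignType) → ℝ) :
    stepMean p H = stepMean p fun s => (1 - 2 * p) * H (Fin.cons 0 s) + p * H (Fin.cons 1 s)
      + p * H (Fin.cons (-1) s) := by
  unfold stepMean
  rw [← (Fin.consEquiv fun _ => SignType).sum_comp, Fintype.sum_prod_type, Finset.sum_comm]
  refine Finset.sum_congr rfl fun s _ => ?_
  beta_reduce
  rw [← sum_stepProb_mul p fun c => H (Fin.cons c s), Finset.mul_sum]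
  refine Finset.sum_congr rfl fun c _ => ?_
  simp [Fin.consEquiv, Fin.prod_univ_succ]
  ring

theorem stepMean_const_mul {n : ℕ} (p a : ℝ) (H : (Fin n → SignType) → ℝ) :
    stepMean p (fun s => a * H s) = a * stepMean p H := by
  simp only [stepMean, Finset.mul_sum]
  exact Finset.sum_congr rfl fun s _ => by ring

theorem stepMean_add {n : ℕ} (p : ℝ) (H K : (Fin n → SignType) → ℝ) :
    stepMean p (fun s => H s + K s) = stepMean p H + stepMean p K := by
  simp only [stepMean, ← Finset.sum_add_distrib]
  exact Finset.sum_congr rfl fun s _ => by ring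

theorem stepMean_one {n : ℕ} (p : ℝ) : stepMean p (fun _ : Fin n → SignType => 1) = 1 := by
  induction n with
  | zero => simp [stepMean]
  | succ n ih =>
    rw [stepMean_succ]
    convert! ih using 3
    ring

theorem stepMean_sum_abs {n : ℕ} (p : ℝ) :
    stepMean p (fun s : Fin n → SignType => ∑ i, |((s i : ℤ) : ℝ)|) = 2 * p * n := by
  induction n with
  | zero => simp [stepMean]
  | succ n ih =>
    rw [stepMean_succ]
    have : ∀ s : Fin n → SignType,
        (1 - 2 * p) * (∑ i, |(((Fin.cons 0 s : Fin (n + 1) → SignType) i : ℤ) : ℝ)|)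
        + p * (∑ i, |(((Fin.cons 1 s : Fin (n + 1) → SignType) i : ℤ) : ℝ)|)
        + p * (∑ i, |(((Fin.cons (-1) s : Fin (n + 1) → SignType) i : ℤ) : ℝ)|)
        = (∑ i, |((s i : ℤ) : ℝ)|) + 2 * p * 1 := by
      intro s
      simp only [Fin.sum_univ_succ, Fin.cons_zero, Fin.cons_succ]
      simp
      ring
    simp only [this]
    rw [stepMean_add, ih, stepMean_const_mul, stepMean_one]
    push_cast; ring

theorem stepMean_levelCost (n : ℕ) :
    stepMean (1 / 6) (fun s : Fin n → SignType => (levelCost s : ℝ))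
      = (n / 3 + expectedDistance (1 / 6) n) / 2 := by
  have h : (fun s : Fin n → SignType => (levelCost s : ℝ)) = fun s =>
      1 / 2 * ((∑ i, |((s i : ℤ) : ℝ)|) + |∑ i, ((s i : ℤ) : ℝ)|) := by
    ext s; rw [levelCost_eq]; ring
  rw [h, stepMean_const_mul, stepMean_add, stepMean_sum_abs]
  simp only [stepMean, expectedDistance]
  ring

/-! ### The mean word length over a box -/

/-- A number below `2 ^ (U + V)` is given by its lowest `U` bits and the remaining ones. -/
theorem sum_box_add {n : ℕ} (U V : ℕ) (F : (Fin n → ℕ) → ℝ) :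
    ∑ u ∈ box n (U + V), F u
      = ∑ r ∈ box n U, ∑ a ∈ box n V, F (fun i => r i + 2 ^ U * a i) := by
  rw [← Finset.sum_product']
  symm
  refine Finset.sum_nbij' (fun x i => x.1 i + 2 ^ U * x.2 i)
    (fun u => (fun i => u i % 2 ^ U, fun i => u i / 2 ^ U)) ?_ ?_ ?_ ?_ ?_
  · rintro ⟨r, a⟩ h
    rw [Finset.mem_product, mem_box, mem_box] at h
    rw [mem_box]
    intro i
    have h1 := h.1 i
    have h2 : a i + 1 ≤ 2 ^ V := h.2 i
    have h3 := Nat.mul_le_mul_left (2 ^ U) h2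
    rw [pow_add]
    dsimp only at h1 ⊢
    linarith
  · intro u h
    rw [mem_box] at h
    rw [Finset.mem_product, mem_box, mem_box]
    refine ⟨fun i => Nat.mod_lt _ (by positivity), fun i => ?_⟩
    have := h i
    rw [pow_add] at this
    exact Nat.div_lt_of_lt_mul this
  · rintro ⟨r, a⟩ h
    rw [Finset.mem_product, mem_box, mem_box] at h
    refine Prod.ext (funext fun i => ?_) (funext fun i => ?_)
    · have h1 := h.1 i
      simp [Nat.add_mul_mod_self_left, Nat.mod_eq_of_lt h1]
    · have h1 := h.1 i
      dsimp only at h1 ⊢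
      rw [Nat.add_mul_div_left _ _ (by positivity), Nat.div_eq_of_lt h1, zero_add]
  · intro u _
    exact funext fun i => Nat.mod_add_div _ _
  · intro _ _
    rfl

/-- The word length of a vector of natural numbers, completed by one balancing entry. -/
noncomputable def natCost {n : ℕ} (u : Fin n → ℕ) : ℝ := balancedCost (fun i => (u i : ℤ))

theorem natCost_nonneg {n : ℕ} (u : Fin n → ℕ) : 0 ≤ natCost u := Nat.cast_nonneg _

theorem cast_add_two_pow_mul {n : ℕ} (U : ℕ) (r a : Fin n → ℕ) :
    (fun i => ((r i + 2 ^ U * a i : ℕ) : ℤ))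
      = (fun i => (r i : ℤ)) + (2 ^ U : ℤ) • fun i => (a i : ℤ) := by
  ext i; simp

theorem natCost_add_two_pow_mul_le {n : ℕ} (U : ℕ) (r a : Fin n → ℕ) :
    natCost (fun i => r i + 2 ^ U * a i) ≤ natCost r + natCost a := by
  unfold natCost
  rw [cast_add_two_pow_mul]
  exact_mod_cast (balancedCost_add_le _ _).trans
    (Nat.add_le_add_left (balancedCost_two_pow_smul_le _ _) _)

theorem natCost_le_add_two_pow_mul {n : ℕ} (U : ℕ) (r a : Fin n → ℕ) :
    natCost r ≤ natCost (fun i => r i + 2 ^ U * a i) + natCost a := by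
  unfold natCost
  rw [cast_add_two_pow_mul]
  exact_mod_cast (balancedCost_le_add _ _).trans
    (Nat.add_le_add_left (balancedCost_two_pow_smul_le _ _) _)

/-- The mean of `natCost` over the vectors with entries below `2 ^ W`. -/
noncomputable def boxMean (n W : ℕ) : ℝ := (∑ u ∈ box n W, natCost u) / (2 ^ W) ^ n

theorem boxMean_nonneg (n W : ℕ) : 0 ≤ boxMean n W :=
  div_nonneg (Finset.sum_nonneg fun u _ => natCost_nonneg u) (by positivity)

theorem sum_box_const (n W : ℕ) (a : ℝ) : ∑ _u ∈ box n W, a = (2 ^ W) ^ n * a := by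
  rw [Finset.sum_const, card_box]; simp

theorem subadditive_boxMean (n : ℕ) : Subadditive (boxMean n) := by
  intro U V
  unfold boxMean
  rw [div_add_div _ _ (by positivity) (by positivity), pow_add, mul_pow]
  gcongr
  calc ∑ u ∈ box n (U + V), natCost u
      ≤ ∑ r ∈ box n U, ∑ a ∈ box n V, (natCost r + natCost a) := by
        rw [sum_box_add]
        exact Finset.sum_le_sum fun r _ => Finset.sum_le_sum fun a _ =>
          natCost_add_two_pow_mul_le U r a
    _ = _ := by
        simp only [Finset.sum_add_distrib, sum_box_const, ← Finset.mul_sum]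
        ring

/-- The growth rate of the mean word length over boxes. -/
noncomputable def boxLimit (n : ℕ) : ℝ := (subadditive_boxMean n).lim

theorem tendsto_boxMean_div (n : ℕ) :
    Tendsto (fun W : ℕ => boxMean n W / W) atTop (𝓝 (boxLimit n)) := by
  refine (subadditive_boxMean n).tendsto_lim ⟨0, ?_⟩
  rintro _ ⟨W, rfl⟩
  exact div_nonneg (boxMean_nonneg n W) (Nat.cast_nonneg W)

theorem tendsto_boxMean_succ_div (n : ℕ) :
    Tendsto (fun W : ℕ => boxMean n (W + 1) / (W + 1)) atTop (𝓝 (boxLimit n)) := by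
  have := (tendsto_add_atTop_iff_nat 1).2 (tendsto_boxMean_div n)
  simpa using this

theorem tendsto_sum_add_div {m : ℕ → ℝ} {a : ℝ} (h : Tendsto m atTop (𝓝 a)) (c : ℝ) :
    Tendsto (fun W : ℕ => (∑ l ∈ Finset.range W, m l + c) / (W + 1)) atTop (𝓝 a) := by
  have h1 := h.cesaro.mul (tendsto_natCast_div_add_atTop (1 : ℝ))
  have h2 := (tendsto_const_div_atTop_nhds_zero_nat c).comp (tendsto_add_atTop_nat 1)
  have h3 := h1.add h2
  rw [mul_one, add_zero] at h3
  refine h3.congr fun W => ?_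
  rcases W with _ | W
  · simp
  · simp only [Function.comp]
    push_cast
    have : (W : ℝ) + 1 ≠ 0 := by positivity
    have : (W : ℝ) + 1 + 1 ≠ 0 := by positivity
    field_simp

/-- The top digit is left out because its law is not that of the others; it costs at most `n`. -/
theorem boxMean_succ_le (n W : ℕ) : boxMean n (W + 1) ≤
    ∑ l ∈ Finset.range W, stepMean (digitProb l) (fun s : Fin n → SignType => (levelCost s : ℝ))
      + 2 * n := by
  unfold boxMean
  rw [div_le_iff₀ (by positivity)]
  calc ∑ u ∈ box n (W + 1), natCost u
      ≤ ∑ u ∈ box n (W + 1), ((∑ l ∈ Finset.range W,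
          (levelCost (fun i => nafDigit (u i) l) : ℝ)) + 2 * n) := by
        refine Finset.sum_le_sum fun u hu => ?_
        rw [mem_box] at hu
        have h := balancedCost_le_sum_levelCost (W + 1) (fun i => (u i : ℤ))
          (fun i => Int.natCast_nonneg _) (fun i => by exact_mod_cast (hu i).le)
        rw [Finset.sum_range_succ] at h
        have h' := levelCost_le (fun i => nafDigit (u i) W)
        have h'' : balancedCost (fun i => (u i : ℤ)) ≤
            ∑ l ∈ Finset.range W, levelCost (fun i => nafDigit (u i) l) + 2 * n := by
          omega
        unfold natCost
        exact_mod_cast h''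
    _ = _ := by
        rw [Finset.sum_add_distrib, sum_box_const, Finset.sum_comm, add_mul, Finset.sum_mul]
        congr 1
        · refine Finset.sum_congr rfl fun l hl => ?_
          rw [sum_box_nafDigit l (W + 1) (by have := Finset.mem_range.1 hl; omega)
            (fun s => (levelCost s : ℝ)), mul_comm]
        · ring

theorem le_boxMean_succ (n W : ℕ) :
    ∑ l ∈ Finset.range W, digitProb l * n ≤ boxMean n (W + 1) := by
  unfold boxMean
  rw [le_div_iff₀ (by positivity)]
  calc (∑ l ∈ Finset.range W, digitProb l * n) * (2 ^ (W + 1)) ^ n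
      = ∑ u ∈ box n (W + 1), 1 / 2 * (∑ l ∈ Finset.range W,
          ∑ i, |((nafDigit (u i) l : ℤ) : ℝ)|) := by
        rw [← Finset.mul_sum, Finset.sum_comm, Finset.sum_mul, Finset.mul_sum]
        refine Finset.sum_congr rfl fun l hl => ?_
        rw [sum_box_nafDigit l (W + 1) (by have := Finset.mem_range.1 hl; omega)
          (fun s => ∑ i, |((s i : ℤ) : ℝ)|), stepMean_sum_abs]
        ring
    _ ≤ ∑ u ∈ box n (W + 1), natCost u := by
        refine Finset.sum_le_sum fun u _ => ?_
        have h := sum_nafWeight_le_two_mul_balancedCost W (fun i => (u i : ℤ))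
        have h' : ∑ l ∈ Finset.range W, ∑ i, |((nafDigit (u i) l : ℤ) : ℝ)|
            = ((∑ i, nafWeight W (u i) : ℕ) : ℝ) := by
          rw [Finset.sum_comm]
          push_cast [nafWeight]
          refine Finset.sum_congr rfl fun i _ => Finset.sum_congr rfl fun l _ => ?_
          rcases nafDigit (u i) l <;> simp
        rw [h']
        have h2 : ((∑ i, nafWeight W (u i) : ℕ) : ℝ) ≤ 2 * natCost u := by
          unfold natCost
          exact_mod_cast h
        linarith

theorem boxLimit_le (n : ℕ) : boxLimit n ≤ (n / 3 + expectedDistance (1 / 6) n) / 2 := by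
  rw [← stepMean_levelCost]
  refine le_of_tendsto_of_tendsto' (tendsto_boxMean_succ_div n)
    (tendsto_sum_add_div (tendsto_stepMean _) (2 * n)) fun W => ?_
  gcongr
  exact boxMean_succ_le n W

theorem le_boxLimit (n : ℕ) : (n : ℝ) / 6 ≤ boxLimit n := by
  have h := tendsto_sum_add_div (tendsto_digitProb.mul_const (n : ℝ)) 0
  rw [one_div_mul_eq_div] at h
  refine le_of_tendsto_of_tendsto' h (tendsto_boxMean_succ_div n) fun W => ?_
  rw [add_zero]
  gcongr
  exact le_boxMean_succ n W

/-! ### From boxes to ordered partitions -/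

/-- The vectors of `n` natural numbers with sum at most `m`. -/
def simplex (n m : ℕ) : Finset (Fin n → ℕ) :=
  (Fintype.piFinset fun _ => Finset.range (m + 1)).filter fun u => ∑ i, u i ≤ m

theorem mem_simplex {n m : ℕ} {u : Fin n → ℕ} : u ∈ simplex n m ↔ ∑ i, u i ≤ m := by
  simp only [simplex, Finset.mem_filter, Fintype.mem_piFinset, Finset.mem_range,
    and_iff_right_iff_imp]
  intro h i
  have := Finset.single_le_sum (f := u) (fun _ _ => Nat.zero_le _) (Finset.mem_univ i)
  omega

theorem simplex_subset_box {n m V : ℕ} (h : m < 2 ^ V) : simplex n m ⊆ box n V := by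
  intro u hu
  rw [mem_simplex] at hu
  rw [mem_box]
  intro i
  have := Finset.single_le_sum (f := u) (fun _ _ => Nat.zero_le _) (Finset.mem_univ i)
  omega

theorem card_simplex (n m : ℕ) : (simplex n m).card = (m + n).choose n := by
  have h : (simplex n m).card
      = (Finset.piAntidiag (Finset.univ : Finset (Fin (n + 1))) m).card := by
    refine Finset.card_nbij' (fun u => Fin.cons (m - ∑ i, u i) u) (fun p i => p i.succ)
      ?_ ?_ ?_ ?_
    · intro u hu
      rw [Finset.mem_coe, mem_simplex] at hu
      simp [Finset.mem_piAntidiag, Fin.sum_univ_succ, hu]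
    · intro p hp
      have hp := (Finset.mem_piAntidiag.1 hp).1
      rw [Fin.sum_univ_succ] at hp
      rw [Finset.mem_coe, mem_simplex]
      dsimp only
      omega
    · intro u _
      rfl
    · intro p hp
      have hp := (Finset.mem_piAntidiag.1 hp).1
      rw [Fin.sum_univ_succ] at hp
      ext i
      refine Fin.cases ?_ (fun i => ?_) i
      · simp only [Fin.cons_zero]; omega
      · simp
  rw [h, ← Finset.map_sym_eq_piAntidiag, Finset.card_map, Finset.sym_univ, Finset.card_univ,
    Sym.card_sym_eq_choose, Fintype.card_fin, show n + 1 + m - 1 = m + n by omega]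
  exact Nat.choose_symm_add

theorem simplex_card_pos (n m : ℕ) : 0 < ((simplex n m).card : ℝ) := by
  rw [card_simplex]
  exact_mod_cast Nat.choose_pos (Nat.le_add_left n m)

theorem tendsto_card_simplex_ratio (n c : ℕ) :
    Tendsto (fun m : ℕ => ((simplex n m).card : ℝ) / (simplex n (m + c)).card) atTop (𝓝 1) := by
  have h1 : Tendsto (fun m : ℕ => m + n) atTop atTop := tendsto_add_atTop_nat n
  have h2 : Tendsto (fun m : ℕ => m + c + n) atTop atTop := by
    simpa [add_assoc] using tendsto_add_atTop_nat (c + n)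
  have h3 := (isEquivalent_choose n).comp_tendsto h1
  have h4 := (isEquivalent_choose n).comp_tendsto h2
  have h5 := (h3.div h4).symm
  simp only [card_simplex]
  refine (h5.tendsto_nhds ?_)
  have h6 : Tendsto (fun m : ℕ => (((m + n : ℕ) : ℝ) / ((m + n : ℕ) + (c : ℝ))) ^ n) atTop
      (𝓝 (1 ^ n)) :=
    ((tendsto_natCast_div_add_atTop (c : ℝ)).comp h1).pow n
  rw [one_pow] at h6
  refine h6.congr fun m => ?_
  simp only [Function.comp, Pi.div_apply]
  rw [div_div_div_cancel_right₀ (by positivity), ← div_pow]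
  push_cast
  ring_nf

/-- The mean of `natCost` over the vectors with sum at most `m`. -/
noncomputable def simplexMean (n m : ℕ) : ℝ :=
  (∑ u ∈ simplex n m, natCost u) / (simplex n m).card

/-- A partition of `2 ^ W` into `n + 1` positive parts is given by all parts but the first,
lowered by one. -/
theorem sum_orderedPartitions {n W : ℕ} (hW : n + 1 ≤ 2 ^ W) (F : (Fin (n + 1) → ℕ) → ℝ) :
    ∑ p ∈ orderedPartitions (n + 1) W, F p = ∑ q ∈ simplex n (2 ^ W - (n + 1)),
      F (Fin.cons (2 ^ W - n - ∑ i, q i) fun i => q i + 1) := by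
  refine Finset.sum_nbij' (fun p i => p i.succ - 1)
    (fun q => Fin.cons (2 ^ W - n - ∑ i, q i) fun i => q i + 1) ?_ ?_ ?_ ?_ ?_
  all_goals
    have hsum : ∀ p ∈ orderedPartitions (n + 1) W, (∀ i, 0 < p i) ∧
        p 0 + ∑ i : Fin n, (p i.succ - 1) = 2 ^ W - n := by
      intro p hp
      rw [orderedPartitions, Finset.mem_filter, Finset.mem_piAntidiag, Fin.sum_univ_succ] at hp
      refine ⟨hp.2, ?_⟩
      have : ∑ i : Fin n, p i.succ = ∑ i : Fin n, (p i.succ - 1) + n := by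
        rw [Finset.sum_congr rfl (g := fun i : Fin n => (p i.succ - 1) + 1) fun i _ => by
          have := hp.2 i.succ; omega, Finset.sum_add_distrib]
        simp
      omega
  · intro p hp
    have h := hsum p hp
    have := h.1 0
    rw [mem_simplex]
    omega
  · intro q hq
    rw [mem_simplex] at hq
    rw [orderedPartitions, Finset.mem_filter, Finset.mem_piAntidiag, Fin.sum_univ_succ]
    refine ⟨⟨?_, by simp⟩, ?_⟩
    · simp only [Fin.cons_zero, Fin.cons_succ, Finset.sum_add_distrib]
      simp
      omega
    · intro i
      refine Fin.cases ?_ (fun i => ?_) i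
      · simp only [Fin.cons_zero]; omega
      · simp
  · intro p hp
    have h := hsum p hp
    ext i
    refine Fin.cases ?_ (fun i => ?_) i
    · simp only [Fin.cons_zero]; omega
    · have := h.1 i.succ
      simp only [Fin.cons_succ]; omega
  · intro q hq
    ext i
    simp
  · intro p hp
    have h := hsum p hp
    congr 1
    ext i
    refine Fin.cases ?_ (fun i => ?_) i
    · simp only [Fin.cons_zero]; omega
    · have := h.1 i.succ
      simp only [Fin.cons_succ]; omega

theorem abs_complexity_sub_natCost_le {n W : ℕ} (hW : n + 1 ≤ 2 ^ W) {q : Fin n → ℕ}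
    (hq : q ∈ simplex n (2 ^ W - (n + 1))) :
    |(complexity (Fin.cons (2 ^ W - n - ∑ i, q i) fun i => q i + 1 : Fin (n + 1) → ℕ) : ℝ)
      - natCost q| ≤ n + 1 := by
  rw [mem_simplex] at hq
  -- Besides the `n` units added to the parts of `q`, one transaction moves the total `2 ^ W`.
  let t : Transaction (n + 1) := ⟨some 0, none, W⟩
  have hp : (fun i => (((Fin.cons (2 ^ W - n - ∑ i, q i) fun i => q i + 1 :
      Fin (n + 1) → ℕ) i : ℕ) : ℤ))
      = balance (fun i => (q i : ℤ)) + (balance (fun _ => 1) + t.delta) := by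
    ext i
    refine Fin.cases ?_ (fun i => ?_) i
    · simp only [Fin.cons_zero, balance, Pi.add_apply, Transaction.delta, t]
      rw [Nat.sub_sub, Nat.cast_sub (by omega)]
      push_cast
      simp
      ring
    · simp [balance, Transaction.delta, t, Fin.succ_ne_zero]
  have hextra : cost (balance (fun _ : Fin n => (1 : ℤ)) + t.delta) ≤ n + 1 := by
    refine (cost_add_le _ _).trans (add_le_add ?_ (cost_delta_le_one t))
    have := balancedCost_le_of_card_le n (fun _ : Fin n => (1 : SignType))
      ((Finset.card_filter_le _ _).trans (by simp)) ((Finset.card_filter_le _ _).trans (by simp))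
    simpa [balancedCost] using this
  rw [complexity_eq_cost, hp, natCost, balancedCost]
  have h1 := cost_add_le (balance fun i => (q i : ℤ)) (balance (fun _ : Fin n => 1) + t.delta)
  have h2 := cost_le_cost_add (balance fun i => (q i : ℤ))
    (balance (fun _ : Fin n => 1) + t.delta)
  have h1' := h1.trans (Nat.add_le_add_left hextra _)
  have h2' := h2.trans (Nat.add_le_add_left hextra _)
  rw [abs_le]
  constructor
  · have : (cost (balance fun i => (q i : ℤ)) : ℝ) ≤ (cost ((balance fun i => (q i : ℤ)) +
        (balance (fun _ : Fin n => 1) + t.delta)) : ℝ) + (n + 1) := by exact_mod_cast h2'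
    linarith
  · have : (cost ((balance fun i => (q i : ℤ)) + (balance (fun _ : Fin n => 1) + t.delta)) : ℝ)
      ≤ (cost (balance fun i => (q i : ℤ)) : ℝ) + (n + 1) := by exact_mod_cast h1'
    linarith

theorem abs_expectedComplexity_sub_le {n W : ℕ} (hW : n + 1 ≤ 2 ^ W) :
    |expectedComplexity (n + 1) W - simplexMean n (2 ^ W - (n + 1))| ≤ n + 1 := by
  have hcard : ((orderedPartitions (n + 1) W).card : ℝ) = (simplex n (2 ^ W - (n + 1))).card := by
    simpa using sum_orderedPartitions hW (fun _ => 1)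
  have hpos := simplex_card_pos n (2 ^ W - (n + 1))
  rw [expectedComplexity, simplexMean, hcard, sum_orderedPartitions hW, ← sub_div,
    ← Finset.sum_sub_distrib, abs_div, abs_of_pos hpos, div_le_iff₀ hpos]
  refine (Finset.abs_sum_le_sum_abs _ _).trans ((Finset.sum_le_sum fun q hq =>
    abs_complexity_sub_natCost_le hW hq).trans ?_)
  rw [Finset.sum_const, nsmul_eq_mul, mul_comm]

/-- The vectors of high bits that complete the low bits `r` to a vector with sum at most `m`. -/
def completions {n : ℕ} (U V m : ℕ) (r : Fin n → ℕ) : Finset (Fin n → ℕ) :=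
  (box n V).filter fun a => ∑ i, (r i + 2 ^ U * a i) ≤ m

theorem sum_simplex_eq {n U V m : ℕ} (h : m < 2 ^ (U + V)) (F : (Fin n → ℕ) → ℝ) :
    ∑ q ∈ simplex n m, F q
      = ∑ r ∈ box n U, ∑ a ∈ completions U V m r, F (fun i => r i + 2 ^ U * a i) := by
  have h1 : simplex n m = (box n (U + V)).filter fun q => ∑ i, q i ≤ m := by
    ext q
    rw [Finset.mem_filter, ← mem_simplex]
    exact ⟨fun hq => ⟨simplex_subset_box h hq, hq⟩, fun hq => hq.2⟩
  rw [h1, Finset.sum_filter, sum_box_add]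
  refine Finset.sum_congr rfl fun r _ => ?_
  rw [completions, Finset.sum_filter]

/-- Whatever the low bits are, nearly the same number of vectors of high bits completes them.
This makes the low bits of a random point of the simplex nearly uniform. -/
theorem card_completions {n U V : ℕ} (hV : 2 * n + 1 ≤ 2 ^ V) {r : Fin n → ℕ} (hr : r ∈ box n U) :
    (simplex n (2 ^ V - (2 * n + 1))).card ≤ (completions U V (2 ^ (U + V) - (n + 1)) r).card ∧
      (completions U V (2 ^ (U + V) - (n + 1)) r).card ≤ (simplex n (2 ^ V)).card := by
  rw [mem_box] at hr
  have hsum : ∀ a : Fin n → ℕ, ∑ i, (r i + 2 ^ U * a i) = ∑ i, r i + 2 ^ U * ∑ i, a i := by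
    intro a; rw [Finset.sum_add_distrib, Finset.mul_sum]
  constructor
  · refine Finset.card_le_card fun a ha => ?_
    rw [completions, Finset.mem_filter]
    refine ⟨simplex_subset_box (by omega) ha, ?_⟩
    rw [mem_simplex] at ha
    have h1 : ∑ i, r i ≤ n * 2 ^ U := by
      have := Finset.sum_le_card_nsmul Finset.univ r (2 ^ U) fun i _ => (hr i).le
      simpa using this
    have h2 := Nat.mul_le_mul_left (2 ^ U) (show ∑ i, a i + (2 * n + 1) ≤ 2 ^ V by omega)
    have h3 := Nat.mul_le_mul_right (n + 1) (Nat.one_le_two_pow (n := U))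
    rw [← pow_add] at h2
    rw [hsum]
    refine Nat.le_sub_of_add_le ?_
    nlinarith
  · refine Finset.card_le_card fun a ha => ?_
    rw [completions, Finset.mem_filter, hsum] at ha
    rw [mem_simplex]
    have h1 : 2 ^ U * ∑ i, a i ≤ 2 ^ U * 2 ^ V := by
      rw [← pow_add]
      exact (Nat.le_add_left _ _).trans (ha.2.trans (Nat.sub_le _ _))
    exact Nat.le_of_mul_le_mul_left h1 (by positivity)

theorem natCost_le_of_mem_box {n V : ℕ} {a : Fin n → ℕ} (ha : a ∈ box n V) :
    natCost a ≤ (V + 1) * n := by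
  rw [mem_box] at ha
  have := balancedCost_le_mul V (fun i => (a i : ℤ)) (fun i => Int.natCast_nonneg _)
    (fun i => by exact_mod_cast (ha i).le)
  unfold natCost
  exact_mod_cast this

/-- Comparison of the means over a simplex and over the box of the `U` lowest bits; `ρ` bounds the
deviation of the low bits from uniformity, and `(V + 1) n` the word length of the high bits. -/
theorem simplexMean_bounds {n U V : ℕ} (hV : 2 * n + 1 ≤ 2 ^ V) {ρ : ℝ}
    (hρ : ρ = ((simplex n (2 ^ V - (2 * n + 1))).card : ℝ) / (simplex n (2 ^ V)).card) :
    ρ * boxMean n U - (V + 1) * n ≤ simplexMean n (2 ^ (U + V) - (n + 1)) ∧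
      simplexMean n (2 ^ (U + V) - (n + 1)) ≤ ρ⁻¹ * boxMean n U + (V + 1) * n := by
  set m := 2 ^ (U + V) - (n + 1) with hm
  have hmlt : m < 2 ^ (U + V) := by
    have : 0 < 2 ^ (U + V) := by positivity
    omega
  set A : ℝ := ((simplex n (2 ^ V - (2 * n + 1))).card : ℝ) with hA
  set B : ℝ := ((simplex n (2 ^ V)).card : ℝ) with hB
  have hApos : 0 < A := simplex_card_pos _ _
  have hBpos : 0 < B := simplex_card_pos _ _
  set C : ℝ := ((simplex n m).card : ℝ) with hC
  have hCpos : 0 < C := simplex_card_pos _ _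
  have hN : ∀ r ∈ box n U, A ≤ ((completions U V m r).card : ℝ) ∧
      ((completions U V m r).card : ℝ) ≤ B := fun r hr =>
    ⟨Nat.cast_le.2 (card_completions hV hr).1, Nat.cast_le.2 (card_completions hV hr).2⟩
  have hCsum : C = ∑ r ∈ box n U, ((completions U V m r).card : ℝ) := by
    have := sum_simplex_eq (n := n) hmlt (fun _ => (1 : ℝ))
    simpa using this
  have hCA : (2 ^ U) ^ n * A ≤ C := by
    rw [hCsum, ← sum_box_const]
    exact Finset.sum_le_sum fun r hr => (hN r hr).1
  have hCB : C ≤ (2 ^ U) ^ n * B := by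
    rw [hCsum, ← sum_box_const]
    exact Finset.sum_le_sum fun r hr => (hN r hr).2
  set S : ℝ := ∑ r ∈ box n U, natCost r with hS
  have hS0 : 0 ≤ S := Finset.sum_nonneg fun r _ => natCost_nonneg r
  have hbox : boxMean n U = S / (2 ^ U) ^ n := rfl
  have hMpos : (0 : ℝ) < (2 ^ U) ^ n := by positivity
  have hup : ∑ q ∈ simplex n m, natCost q ≤ B * S + C * ((V + 1) * n) := by
    rw [sum_simplex_eq hmlt, hCsum, hS, Finset.mul_sum, Finset.sum_mul, ← Finset.sum_add_distrib]
    refine Finset.sum_le_sum fun r hr => ?_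
    calc ∑ a ∈ completions U V m r, natCost (fun i => r i + 2 ^ U * a i)
        ≤ ∑ _a ∈ completions U V m r, (natCost r + (V + 1) * n) := by
          refine Finset.sum_le_sum fun a ha => ?_
          have := natCost_le_of_mem_box (Finset.mem_filter.1 ha).1
          have := natCost_add_two_pow_mul_le U r a
          linarith
      _ = (completions U V m r).card * natCost r
          + (completions U V m r).card * ((V + 1) * n) := by
          rw [Finset.sum_const, nsmul_eq_mul, mul_add]
      _ ≤ _ := by
          gcongr
          · exact natCost_nonneg r
          · exact (hN r hr).2
  have hlo : A * S - C * ((V + 1) * n) ≤ ∑ q ∈ simplex n m, natCost q := by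
    rw [sum_simplex_eq hmlt, hCsum, hS, Finset.mul_sum, Finset.sum_mul, ← Finset.sum_sub_distrib]
    refine Finset.sum_le_sum fun r hr => ?_
    calc A * natCost r - (completions U V m r).card * ((V + 1) * n)
        ≤ (completions U V m r).card * natCost r
          - (completions U V m r).card * ((V + 1) * n) := by
          gcongr
          · exact natCost_nonneg r
          · exact (hN r hr).1
      _ = ∑ _a ∈ completions U V m r, (natCost r - (V + 1) * n) := by
          rw [Finset.sum_const, nsmul_eq_mul, mul_sub]
      _ ≤ _ := by
          refine Finset.sum_le_sum fun a ha => ?_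
          have := natCost_le_of_mem_box (Finset.mem_filter.1 ha).1
          have := natCost_le_add_two_pow_mul U r a
          linarith
  constructor
  · rw [simplexMean, ← hC, le_div_iff₀ hCpos]
    refine le_trans ?_ hlo
    rw [sub_mul, mul_comm C]
    refine sub_le_sub ?_ le_rfl
    rw [hρ, hbox, div_mul_div_comm, div_mul_eq_mul_div, div_le_iff₀ (by positivity), mul_comm B]
    exact mul_le_mul_of_nonneg_left hCB (by positivity)
  · rw [simplexMean, ← hC, div_le_iff₀ hCpos]
    refine hup.trans ?_
    rw [add_mul _ _ C, mul_comm C]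
    refine add_le_add ?_ le_rfl
    rw [hρ, hbox, inv_div, div_mul_div_comm, div_mul_eq_mul_div, le_div_iff₀ (by positivity),
      mul_comm A]
    exact mul_le_mul_of_nonneg_left hCA (by positivity)

theorem tendsto_natSqrt : Tendsto Nat.sqrt atTop atTop :=
  tendsto_atTop_mono' atTop (Eventually.of_forall fun _ => le_rfl)
    (tendsto_atTop_atTop.2 fun b => ⟨b * b, fun _ hW => Nat.le_sqrt.2 hW⟩)

theorem tendsto_natSqrt_div : Tendsto (fun W : ℕ => (W.sqrt : ℝ) / W) atTop (𝓝 0) := by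
  refine squeeze_zero (fun W => by positivity) (fun W => ?_)
    (tendsto_inv_atTop_nhds_zero_nat.comp tendsto_natSqrt)
  rcases Nat.eq_zero_or_pos W with rfl | hW
  · simp
  have h1 : (W.sqrt : ℝ) * W.sqrt ≤ W := by exact_mod_cast Nat.sqrt_le W
  have h2 : (0 : ℝ) < W.sqrt := by exact_mod_cast Nat.sqrt_pos.2 hW
  have h3 : (0 : ℝ) < W := by exact_mod_cast hW
  simp only [Function.comp]
  rw [div_le_iff₀ h3, ← div_eq_inv_mul, le_div_iff₀ h2]
  exact h1

theorem tendsto_expectedComplexity_div (n : ℕ) :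
    Tendsto (fun W : ℕ => expectedComplexity (n + 1) W / W) atTop (𝓝 (boxLimit n)) := by
  -- The number of high bits grows, but slower than the number of all bits.
  let V : ℕ → ℕ := Nat.sqrt
  let ρ : ℕ → ℝ := fun W =>
    ((simplex n (2 ^ V W - (2 * n + 1))).card : ℝ) / (simplex n (2 ^ V W)).card
  have hpow : Tendsto (fun W => 2 ^ V W) atTop atTop :=
    (tendsto_pow_atTop_atTop_of_one_lt one_lt_two).comp tendsto_natSqrt
  have hVlarge : ∀ᶠ W in atTop, 2 * n + 1 ≤ 2 ^ V W := hpow.eventually_ge_atTop _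
  have hρ : Tendsto ρ atTop (𝓝 1) := by
    have h := (tendsto_card_simplex_ratio n (2 * n + 1)).comp
      ((tendsto_sub_atTop_nat (2 * n + 1)).comp hpow)
    refine h.congr' (hVlarge.mono fun W hW => ?_)
    simp only [Function.comp, ρ]
    rw [Nat.sub_add_cancel hW]
  have hVle : ∀ W, V W ≤ W := Nat.sqrt_le_self
  have hU : Tendsto (fun W => W - V W) atTop atTop := by
    refine tendsto_atTop_mono' atTop ?_ tendsto_natSqrt
    filter_upwards [tendsto_natSqrt.eventually_ge_atTop 2] with W hW
    have := Nat.sqrt_le W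
    have : 2 * W.sqrt ≤ W.sqrt * W.sqrt := Nat.mul_le_mul_right _ hW
    simp only [V]
    omega
  have hVdiv : Tendsto (fun W => (V W : ℝ) / W) atTop (𝓝 0) := tendsto_natSqrt_div
  have hone : Tendsto (fun W : ℕ => (1 : ℝ) / W) atTop (𝓝 0) := tendsto_one_div_atTop_nhds_zero_nat
  have hmean : Tendsto (fun W => boxMean n (W - V W) / W) atTop (𝓝 (boxLimit n)) := by
    have h1 := ((tendsto_boxMean_div n).comp hU).mul (hVdiv.const_sub 1)
    rw [sub_zero, mul_one] at h1
    refine h1.congr' ?_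
    filter_upwards [hU.eventually_ge_atTop 1, eventually_ge_atTop 1] with W h h'
    have h2 : ((W - V W : ℕ) : ℝ) ≠ 0 := by
      have : W - V W ≠ 0 := by omega
      exact_mod_cast this
    have h3 : (W : ℝ) ≠ 0 := by positivity
    simp only [Function.comp]
    rw [one_sub_div h3, ← Nat.cast_sub (hVle W)]
    field_simp
  have herr : Tendsto (fun W => ((V W : ℝ) / W + 1 / W) * n + (n + 1) * (1 / W)) atTop (𝓝 0) := by
    have := ((hVdiv.add hone).mul_const (n : ℝ)).add (hone.const_mul ((n : ℝ) + 1))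
    simpa using this
  have hlo := (hρ.mul hmean).sub herr
  have hhi := ((hρ.inv₀ one_ne_zero).mul hmean).add herr
  rw [one_mul, sub_zero] at hlo
  rw [inv_one, one_mul, add_zero] at hhi
  refine tendsto_of_tendsto_of_tendsto_of_le_of_le' hlo hhi ?_ ?_
  all_goals
    filter_upwards [hVlarge, eventually_ge_atTop 1] with W hW hW1
    have hW' : W - V W + V W = W := Nat.sub_add_cancel (hVle W)
    have hpos : (0 : ℝ) < W := by exact_mod_cast hW1
    have hle : n + 1 ≤ 2 ^ W := by
      have := Nat.pow_le_pow_right (n := 2) (by norm_num) (hVle W)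
      omega
    have h1 := abs_le.1 (abs_expectedComplexity_sub_le hle)
    have h2 := simplexMean_bounds (U := W - V W) hW (ρ := ρ W) rfl
    rw [hW'] at h2
  · rw [le_div_iff₀ hpos]
    have : (ρ W * (boxMean n (W - V W) / W)
        - (((V W : ℝ) / W + 1 / W) * n + (n + 1) * (1 / W))) * W
        = ρ W * boxMean n (W - V W) - (V W + 1) * n - (n + 1) := by
      field_simp; ring
    rw [this]
    linarith
  · rw [div_le_iff₀ hpos]
    have : ((ρ W)⁻¹ * (boxMean n (W - V W) / W)
        + (((V W : ℝ) / W + 1 / W) * n + (n + 1) * (1 / W))) * W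
        = (ρ W)⁻¹ * boxMean n (W - V W) + (V W + 1) * n + (n + 1) := by
      field_simp
      ring
    rw [this]
    linarith

theorem tendsto_normalizedComplexity (n : ℕ) :
    Tendsto (fun W : ℕ => normalizedComplexity (n + 1) W) atTop
      (𝓝 (boxLimit n / (n + 1))) := by
  refine ((tendsto_expectedComplexity_div n).div_const ((n : ℝ) + 1)).congr fun W => ?_
  rw [normalizedComplexity, div_div]
  push_cast
  rfl

theorem limitComplexity_succ (n : ℕ) : limitComplexity (n + 1) = boxLimit n / (n + 1) :=
  (tendsto_normalizedComplexity n).limUnder_eq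

/-! ### The lazy random walk -/

/-- The probability that the walk is at the origin after `n` steps. -/
noncomputable def returnProb (n : ℕ) : ℝ :=
  stepMean (1 / 6) fun s : Fin n → SignType => if ∑ i, (s i : ℤ) = 0 then 1 else 0

theorem expectedDistance_eq_stepMean (n : ℕ) : expectedDistance (1 / 6) n
    = stepMean (1 / 6) fun s : Fin n → SignType => |((∑ i, (s i : ℤ) : ℤ) : ℝ)| := by
  simp only [expectedDistance, stepMean, Int.cast_sum]

/-- The mean distance to the origin grows only in steps that leave the origin. -/
theorem expectedDistance_succ (n : ℕ) :
    expectedDistance (1 / 6) (n + 1) = expectedDistance (1 / 6) n + 1 / 3 * returnProb n := by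
  rw [expectedDistance_eq_stepMean, expectedDistance_eq_stepMean, stepMean_succ, returnProb,
    ← stepMean_const_mul, ← stepMean_add]
  congr 1
  ext s
  simp only [Fin.sum_univ_succ, Fin.cons_zero, Fin.cons_succ]
  generalize ∑ i, (s i : ℤ) = m
  have h : |1 + m| + |-1 + m| = 2 * |m| + 2 * if m = 0 then 1 else 0 := by
    split_ifs with h0
    · simp [h0]
    · rcases lt_or_gt_of_ne h0 with h1 | h1
      · rw [abs_of_nonpos, abs_of_neg, abs_of_neg] <;> omega
      · rw [abs_of_pos, abs_of_nonneg, abs_of_pos] <;> omega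
  have h' : |1 + (m : ℝ)| + |-1 + (m : ℝ)| = 2 * |(m : ℝ)| + 2 * if m = 0 then 1 else 0 := by
    exact_mod_cast h
  simp
  split_ifs at h' ⊢ <;> linarith

/-- The characteristic function of the walk. -/
theorem stepMean_cos (n : ℕ) (t : ℝ) :
    stepMean (1 / 6) (fun s : Fin n → SignType => Real.cos (t * ((∑ i, (s i : ℤ) : ℤ) : ℝ)))
      = (1 + (Real.cos t - 1) / 3) ^ n := by
  induction n with
  | zero => simp [stepMean]
  | succ n ih =>
    rw [stepMean_succ, pow_succ', ← ih, ← stepMean_const_mul]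
    congr 1
    ext s
    simp only [Fin.sum_univ_succ, Fin.cons_zero, Fin.cons_succ]
    generalize ∑ i, (s i : ℤ) = m
    simp only [SignType.coe_zero, SignType.coe_one, SignType.coe_neg_one]
    push_cast
    rw [show t * (1 + (m : ℝ)) = t + t * m by ring, show t * (-1 + (m : ℝ)) = -(t - t * m) by ring,
      Real.cos_neg, Real.cos_add, Real.cos_sub]
    ring_nf

theorem integral_cos_mul_int (m : ℤ) :
    ∫ t in (-Real.pi)..Real.pi, Real.cos (t * (m : ℝ))
      = 2 * Real.pi * if m = 0 then 1 else 0 := by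
  split_ifs with h
  · simp [h]; ring
  · have hm : (m : ℝ) ≠ 0 := by exact_mod_cast h
    rw [intervalIntegral.integral_comp_mul_right _ hm, integral_cos, mul_comm Real.pi, neg_mul,
      mul_comm Real.pi, Real.sin_neg, Real.sin_int_mul_pi]
    simp

theorem two_pi_mul_returnProb (n : ℕ) :
    2 * Real.pi * returnProb n
      = ∫ t in (-Real.pi)..Real.pi, (1 + (Real.cos t - 1) / 3) ^ n := by
  simp only [← stepMean_cos, stepMean]
  rw [intervalIntegral.integral_finsetSum
    (fun s _ => (Continuous.intervalIntegrable (by fun_prop) _ _)), returnProb, stepMean,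
    Finset.mul_sum]
  refine Finset.sum_congr rfl fun s _ => ?_
  rw [intervalIntegral.integral_const_mul, integral_cos_mul_int]
  ring

theorem tendsto_cos_pow (u : ℝ) :
    Tendsto (fun n : ℕ => (1 + (Real.cos (u / √n) - 1) / 3) ^ n) atTop
      (𝓝 (Real.exp (-(1 / 6) * u ^ 2))) := by
  refine Real.tendsto_one_add_pow_exp_of_tendsto ?_
  have hsqrt : Tendsto (fun n : ℕ => √(n : ℝ)) atTop atTop :=
    Real.tendsto_sqrt_atTop.comp tendsto_natCast_atTop_atTop
  have hsmall : ∀ᶠ n : ℕ in atTop, |u / √n| ≤ 1 := by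
    have h := ((hsqrt.const_div_atTop u).abs)
    rw [abs_zero] at h
    exact (h.eventually_lt_const one_pos).mono fun _ h => h.le
  rw [tendsto_iff_norm_sub_tendsto_zero]
  have hb : Tendsto (fun n : ℕ => (u ^ 4 * (5 / 96) / 3) / (n : ℝ)) atTop (𝓝 0) :=
    tendsto_const_div_atTop_nhds_zero_nat _
  refine squeeze_zero' (Eventually.of_forall fun _ => norm_nonneg _) ?_ hb
  filter_upwards [hsmall, eventually_ge_atTop 1] with n hn hn1
  have hpos : (0 : ℝ) < n := by exact_mod_cast hn1
  have hsq : √(n : ℝ) ^ 2 = n := Real.sq_sqrt hpos.le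
  have h := Real.cos_bound hn
  have h2 : (u / √(n : ℝ)) ^ 2 = u ^ 2 / n := by rw [div_pow, hsq]
  have h4 : |u / √(n : ℝ)| ^ 4 = u ^ 4 / n ^ 2 := by
    rw [show |u / √(n : ℝ)| ^ 4 = (|u / √(n : ℝ)| ^ 2) ^ 2 by ring, sq_abs, h2]; ring
  rw [h2, h4] at h
  have he : (n : ℝ) * ((Real.cos (u / √n) - 1) / 3) - -(1 / 6) * u ^ 2
      = n / 3 * (Real.cos (u / √n) - (1 - u ^ 2 / n / 2)) := by
    field_simp; ring
  rw [Real.norm_eq_abs, he, abs_mul, abs_of_pos (by positivity)]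
  calc (n : ℝ) / 3 * |Real.cos (u / √n) - (1 - u ^ 2 / n / 2)|
      ≤ n / 3 * (u ^ 4 / n ^ 2 * (5 / 96)) := by gcongr
    _ = u ^ 4 * (5 / 96) / 3 / n := by field_simp

theorem sqrt_mul_integral_cos_pow (n : ℕ) (hn : n ≠ 0) :
    √n * ∫ t in (-Real.pi)..Real.pi, (1 + (Real.cos t - 1) / 3) ^ n
      = ∫ u, (Set.Ioc (-Real.pi * √n) (Real.pi * √n)).indicator
          (fun u => (1 + (Real.cos (u / √n) - 1) / 3) ^ n) u := by
  have hpos : 0 < √(n : ℝ) := Real.sqrt_pos.2 (by positivity)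
  have h := intervalIntegral.integral_comp_div
    (fun t => (1 + (Real.cos t - 1) / 3) ^ n) hpos.ne' (a := -Real.pi * √n) (b := Real.pi * √n)
  rw [mul_div_cancel_right₀ _ hpos.ne', mul_div_cancel_right₀ _ hpos.ne', smul_eq_mul] at h
  rw [← h, intervalIntegral.integral_of_le, MeasureTheory.integral_indicator measurableSet_Ioc]
  have := Real.pi_pos
  nlinarith

/-- Laplace's method for the return probability. -/
theorem tendsto_sqrt_mul_integral_cos_pow :
    Tendsto (fun n : ℕ => √n * ∫ t in (-Real.pi)..Real.pi, (1 + (Real.cos t - 1) / 3) ^ n)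
      atTop (𝓝 √(6 * Real.pi)) := by
  have hlim : √(6 * Real.pi) = ∫ u : ℝ, Real.exp (-(1 / 6) * u ^ 2) := by
    rw [integral_gaussian]; congr 1; ring
  rw [hlim]
  have hdom : Tendsto (fun n : ℕ => ∫ u, (Set.Ioc (-Real.pi * √n) (Real.pi * √n)).indicator
      (fun u => (1 + (Real.cos (u / √n) - 1) / 3) ^ n) u) atTop
      (𝓝 (∫ u : ℝ, Real.exp (-(1 / 6) * u ^ 2))) := by
    refine MeasureTheory.tendsto_integral_filter_of_dominated_convergence
      (fun u => Real.exp (-(2 / (3 * Real.pi ^ 2)) * u ^ 2)) ?_ ?_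
      (integrable_exp_neg_mul_sq (by positivity)) ?_
    · refine Eventually.of_forall fun n => ?_
      refine (Continuous.aestronglyMeasurable ?_).indicator measurableSet_Ioc
      fun_prop
    -- On `[-π, π]`, `cos t ≤ 1 - 2 t² / π²`, which gives a Gaussian bound uniform in `n`.
    · filter_upwards [eventually_ge_atTop 1] with n hn
      refine Eventually.of_forall fun u => ?_
      have hpos : (0 : ℝ) < n := by exact_mod_cast hn
      have hspos : 0 < √(n : ℝ) := Real.sqrt_pos.2 hpos
      by_cases hu : u ∈ Set.Ioc (-Real.pi * √n) (Real.pi * √n)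
      · rw [Set.indicator_of_mem hu, Real.norm_eq_abs, abs_pow]
        have habs : |u / √(n : ℝ)| ≤ Real.pi := by
          rw [abs_le, le_div_iff₀ hspos, div_le_iff₀ hspos]
          exact ⟨hu.1.le, hu.2⟩
        have hcos := Real.cos_le_one_sub_mul_cos_sq habs
        have hge := Real.neg_one_le_cos (u / √n)
        rw [div_pow, Real.sq_sqrt hpos.le] at hcos
        rw [abs_of_nonneg (by linarith)]
        have hle : 1 + (Real.cos (u / √n) - 1) / 3
            ≤ Real.exp (-(2 / (3 * Real.pi ^ 2)) * u ^ 2 / n) := by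
          refine le_trans ?_ (Real.add_one_le_exp _)
          have : -(2 / (3 * Real.pi ^ 2)) * u ^ 2 / n = -(2 / Real.pi ^ 2 * (u ^ 2 / n)) / 3 := by
            field_simp
          rw [this]
          linarith
        calc (1 + (Real.cos (u / √n) - 1) / 3) ^ n
            ≤ Real.exp (-(2 / (3 * Real.pi ^ 2)) * u ^ 2 / n) ^ n :=
              pow_le_pow_left₀ (by linarith) hle n
          _ = Real.exp (-(2 / (3 * Real.pi ^ 2)) * u ^ 2) := by
              rw [← Real.exp_nat_mul]; congr 1; field_simp
      · rw [Set.indicator_of_notMem hu, norm_zero]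
        positivity
    · refine Eventually.of_forall fun u => ?_
      refine (tendsto_cos_pow u).congr' ?_
      have hsqrt : Tendsto (fun n : ℕ => Real.pi * √(n : ℝ)) atTop atTop :=
        (Real.tendsto_sqrt_atTop.comp tendsto_natCast_atTop_atTop).const_mul_atTop Real.pi_pos
      filter_upwards [hsqrt.eventually_gt_atTop |u|] with n hn
      rw [Set.indicator_of_mem]
      have := abs_lt.1 hn
      exact ⟨by rw [neg_mul]; exact this.1, this.2.le⟩
  refine hdom.congr' ?_
  filter_upwards [eventually_ne_atTop 0] with n hn
  exact (sqrt_mul_integral_cos_pow n hn).symm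

theorem tendsto_sqrt_mul_returnProb :
    Tendsto (fun n : ℕ => √n * returnProb n) atTop (𝓝 (√(6 * Real.pi) / (2 * Real.pi))) := by
  refine (tendsto_sqrt_mul_integral_cos_pow.div_const (2 * Real.pi)).congr fun n => ?_
  rw [← two_pi_mul_returnProb]
  have := Real.pi_ne_zero
  field_simp

/-- A form of the Stolz–Cesàro theorem. -/
theorem tendsto_sum_range_div_sqrt {a : ℕ → ℝ} {c : ℝ}
    (h : Tendsto (fun n : ℕ => √n * a n) atTop (𝓝 c)) :
    Tendsto (fun n : ℕ => (∑ j ∈ Finset.range n, a j) / √n) atTop (𝓝 (2 * c)) := by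
  -- The sequence is compared with the increments of the square root.
  let b : ℕ → ℝ := fun j => √((j + 1 : ℕ) : ℝ) - √(j : ℝ)
  have hsum : ∀ n, ∑ j ∈ Finset.range n, b j = √n := fun n => by
    rw [Finset.sum_range_sub (fun j : ℕ => √(j : ℝ))]; simp
  have hbpos : ∀ j, 0 < b j := fun j => sub_pos.2 (Real.sqrt_lt_sqrt (by positivity) (by simp))
  have hsqrt : Tendsto (fun n : ℕ => √(n : ℝ)) atTop atTop :=
    Real.tendsto_sqrt_atTop.comp tendsto_natCast_atTop_atTop
  have hratio : Tendsto (fun j => a j / b j) atTop (𝓝 (2 * c)) := by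
    have h1 : Tendsto (fun j : ℕ => √(1 + 1 / (j : ℝ)) + 1) atTop (𝓝 2) := by
      have h0 := ((tendsto_one_div_atTop_nhds_zero_nat (𝕜 := ℝ)).const_add 1).sqrt.add_const 1
      rw [add_zero, Real.sqrt_one, one_add_one_eq_two] at h0
      exact h0
    refine (h1.mul h).congr' ?_
    filter_upwards [eventually_ge_atTop 1] with j hj
    have hpos : (0 : ℝ) < j := by exact_mod_cast hj
    have h2 : √((j + 1 : ℕ) : ℝ) = √(j : ℝ) * √(1 + 1 / (j : ℝ)) := by
      rw [← Real.sqrt_mul hpos.le]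
      congr 1
      push_cast
      field_simp
    have h3 : √(1 + 1 / (j : ℝ)) ^ 2 = 1 + 1 / j := Real.sq_sqrt (by positivity)
    have h4 : √(j : ℝ) ^ 2 = j := Real.sq_sqrt hpos.le
    rw [eq_div_iff (hbpos j).ne']
    simp only [b]
    rw [h2]
    calc (√(1 + 1 / (j : ℝ)) + 1) * (√j * a j) * (√j * √(1 + 1 / (j : ℝ)) - √j)
        = a j * (√(j : ℝ) ^ 2 * (√(1 + 1 / (j : ℝ)) ^ 2 - 1)) := by ring
      _ = a j := by rw [h3, h4]; field_simp; ring
  have ho : (fun j => a j - 2 * c * b j) =o[atTop] b := by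
    rw [Asymptotics.isLittleO_iff_tendsto fun j hj => absurd hj (hbpos j).ne']
    have := hratio.sub_const (2 * c)
    rw [sub_self] at this
    refine this.congr fun j => ?_
    rw [sub_div, mul_div_cancel_right₀ _ (hbpos j).ne']
  have hs := ho.sum_range (fun j => (hbpos j).le) (by simpa only [hsum] using hsqrt)
  simp only [hsum, Finset.sum_sub_distrib, ← Finset.mul_sum] at hs
  have hz := hs.tendsto_div_nhds_zero.add_const (2 * c)
  rw [zero_add] at hz
  refine hz.congr' ?_
  filter_upwards [hsqrt.eventually_gt_atTop 0] with n hn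
  field_simp
  ring

theorem tendsto_expectedDistance_div_sqrt :
    Tendsto (fun n : ℕ => expectedDistance (1 / 6) n / √n) atTop
      (𝓝 (√(6 * Real.pi) / (3 * Real.pi))) := by
  have hsum : ∀ n, expectedDistance (1 / 6) n = ∑ j ∈ Finset.range n, 1 / 3 * returnProb j := by
    intro n
    induction n with
    | zero => simp [expectedDistance]
    | succ n ih => rw [Finset.sum_range_succ, expectedDistance_succ, ih]
  have h := tendsto_sum_range_div_sqrt (a := fun j => 1 / 3 * returnProb j)
    ((tendsto_sqrt_mul_returnProb.const_mul (1 / 3)).congr fun n => by ring)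
  simp only [hsum]
  convert! h using 2
  have := Real.pi_ne_zero
  field_simp

theorem tendsto_sqrt_mul_boundTerm :
    Tendsto (fun k : ℕ => √(6 * Real.pi * k) * boundTerm k) atTop (𝓝 1) := by
  rw [← tendsto_add_atTop_iff_nat 1]
  have hsqrt : Tendsto (fun n : ℕ => √((n : ℝ) + 1)) atTop atTop :=
    Real.tendsto_sqrt_atTop.comp
      (tendsto_atTop_add_const_right _ _ tendsto_natCast_atTop_atTop)
  have h1 := hsqrt.const_div_atTop 1
  have h2 := (tendsto_natCast_div_add_atTop (1 : ℝ)).sqrt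
  have h3 := ((h1.add (tendsto_expectedDistance_div_sqrt.mul h2)).const_mul
    (√(6 * Real.pi) / 2))
  have hlim : √(6 * Real.pi) / 2 * (0 + √(6 * Real.pi) / (3 * Real.pi) * √1) = 1 := by
    have hsq : √(6 * Real.pi) ^ 2 = 6 * Real.pi := Real.sq_sqrt (by positivity)
    rw [Real.sqrt_one, mul_one, zero_add, div_mul_div_comm, ← sq, hsq]
    have := Real.pi_ne_zero
    field_simp
    norm_num
  rw [hlim] at h3
  refine h3.congr' ?_
  filter_upwards [eventually_ge_atTop 1] with n hn
  have hpos : (0 : ℝ) < n := by exact_mod_cast hn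
  have hs0 : √(n : ℝ) ≠ 0 := (Real.sqrt_pos.2 hpos).ne'
  have hs1 : √((n : ℝ) + 1) ≠ 0 := (Real.sqrt_pos.2 (by positivity)).ne'
  have hsq : √((n : ℝ) + 1) ^ 2 = n + 1 := Real.sq_sqrt (by positivity)
  rw [boundTerm, Nat.add_sub_cancel, Nat.cast_succ,
    Real.sqrt_mul (show 0 ≤ 6 * Real.pi by positivity) ((n : ℝ) + 1), Real.sqrt_div hpos.le,
    show 2 * ((n : ℝ) + 1) = 2 * √((n : ℝ) + 1) ^ 2 by rw [hsq]]
  field_simp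

theorem tendsto_boundTerm : Tendsto boundTerm atTop (𝓝 0) := by
  have hsqrt : Tendsto (fun k : ℕ => √(6 * Real.pi * k)) atTop atTop :=
    Real.tendsto_sqrt_atTop.comp
      (tendsto_natCast_atTop_atTop.const_mul_atTop (by positivity))
  refine (tendsto_sqrt_mul_boundTerm.div_atTop hsqrt).congr' ?_
  filter_upwards [hsqrt.eventually_gt_atTop 0] with k hk
  rw [mul_div_cancel_left₀ _ hk.ne']

/-! ### The limit of the normalized complexity -/

theorem limitComplexity_le (n : ℕ) :
    limitComplexity (n + 1) ≤ 1 / 6 + boundTerm (n + 1) := by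
  rw [limitComplexity_succ, boundTerm, Nat.add_sub_cancel, div_le_iff₀ (by positivity)]
  refine (boxLimit_le n).trans ?_
  push_cast
  have : (1 / 6 + (1 + expectedDistance (1 / 6) n) / (2 * ((n : ℝ) + 1))) * (n + 1)
      = (n / 3 + expectedDistance (1 / 6) n) / 2 + 2 / 3 := by
    field_simp; ring
  rw [this]
  linarith

theorem tendsto_limitComplexity : Tendsto limitComplexity atTop (𝓝 (1 / 6)) := by
  rw [← tendsto_add_atTop_iff_nat 1]
  have hlo := (tendsto_natCast_div_add_atTop (1 : ℝ)).div_const 6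
  have hhi := ((tendsto_add_atTop_iff_nat 1).2 tendsto_boundTerm).const_add (1 / 6)
  rw [add_zero] at hhi
  refine tendsto_of_tendsto_of_tendsto_of_le_of_le hlo hhi (fun n => ?_) limitComplexity_le
  rw [limitComplexity_succ, div_right_comm]
  exact div_le_div_of_nonneg_right (le_boxLimit n) (by positivity)

end TCAM

theorem mainTheorem5 :
    (∀ k : ℕ, 1 ≤ k →
      Tendsto (fun W : ℕ => TCAM.normalizedComplexity k W) atTop (𝓝 (TCAM.limitComplexity k)) ∧
      TCAM.limitComplexity k ≤ 1 / 6 + TCAM.boundTerm k) ∧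
    Tendsto (fun k : ℕ => Real.sqrt (6 * Real.pi * (k : ℝ)) * TCAM.boundTerm k) atTop (𝓝 1) ∧
    Tendsto (fun k : ℕ => TCAM.limitComplexity k) atTop (𝓝 (1 / 6)) := by
  refine ⟨fun k hk => ?_, TCAM.tendsto_sqrt_mul_boundTerm, TCAM.tendsto_limitComplexity⟩
  obtain ⟨n, rfl⟩ := Nat.exists_eq_add_of_le' hk
  refine ⟨?_, TCAM.limitComplexity_le n⟩
  rw [TCAM.limitComplexity_succ]
  exact TCAM.tendsto_normalizedComplexity n
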